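/- Proposition (single internal edge). Let $\Gamma$ be a quantum graph consisting of a single internal edge $[0,l]$, $0<l<\infty$, and $M\ge 0$ semi-infinite leads, possibly in a magnetic field. That is, the Hamiltonian acts as $-(\frac{d}{dx}+iA(x))^2$ on the internal edge, with $A$ real and continuous on $[0,l]$, and as $-\frac{d^2}{dx^2}$ on the leads, with the coupling condition $$(U-I)\Psi+i(U+I)(\Psi'+i\mathcal A\Psi)=0,\qquad \mathcal A=\mathrm{diag}(A(0),-A(l),0,\dots,0),$$ where $U$ is a unitary $(2+M)\times(2+M)$ matrix and $\Psi$, $\Psi'$ are the vectors of the boundary values and of the derivatives in the outgoing direction, ordered as (edge at $0$, edge at $l$, leads). Let $U_A=\mathcal F U\mathcal F^{-1}$ with $\mathcal F=\mathrm{diag}(1,e^{i\Phi},1,\dots,1)$ and $\Phi=\int_0^l A(x)\,dx$ (so $U_A=U$ if $A=0$), write $U_A=\begin{pmatrix}U_1&U_2\\U_3&U_4\end{pmatrix}$ with $U_1$ of size $2\times 2$ and $U_4$ of size $M\times M$, and let $$\tilde U(k)=U_1-(1-k)U_2\,[(1-k)U_4-(k+1)I]^{-1}U_3$$ be the effective coupling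 matrix, with entries $\tilde u_{ij}(k)$, which is defined for those $k\in\mathbb C$ for which the matrix in the bracket is invertible (all but finitely many). A number $k\in\mathbb C\setminus\{0\}$ is a resonance if there is a nonzero function on $\Gamma$ which satisfies the equation $-(\frac{d}{dx}+iA)^2f=k^2f$ on the internal edge, has the form $c_je^{ikx}$ on the $j$-th lead for every $j$, and satisfies the coupling condition. Let $N(R)$ be the number of resonances with $|k|\le R$, each counted with its algebraic multiplicity, that is, with its order as a zero of the determinant of the linear system which, with $A$ gauged away and $U$ replaced by $U_A$, the coupling condition imposes on the coefficients at $\sin kx$, $\cos kx$ (internal edge) and $e^{ikx}$ (each lead). The graph has effective size $W$ if $N(R)=\frac{2}{\pi}WR+O(1)$ as $R\to\infty$. It is called Weyl if its effective size is $l$, and non-Weyl otherwise. Then $\Gamma$ has effective size $0$ if and only if it is non-Weyl and $\tilde u_{12}(k)+\tilde u_{21}(k)=0$ for all $k$ for which $\tilde U(k)$ is defined. Moreover, $\Gamma$ has effective size $0$ if and only if it has only finitely many resonances. -/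

import Mathlib

open Complex Matrix Filter Asymptotics

noncomputable section

/-- A (magnetic) quantum graph with a single internal edge, identified with `[0, length]`, and
`M` semi-infinite leads. The Hamiltonian acts as `-(d/dx + i A)^2` on the internal edge and as
`-d^2/dx^2` on the leads; the self-adjoint coupling is described by one unitary matrix of size
`2 + M`. The two indices in `Fin 2` stand for the endpoints `0` and `length` of the internal edge,
those in `Fin M` for the endpoints of the leads. The graph without magnetic field is the case
`potential = 0`. -/
structure OneEdgeQuantumGraph (M : ℕ) where
  /-- length of the internal edge -/
  length : ℝ
  length_pos : 0 < length
  /-- tangent component `A` of the vector potential on the internal edge -/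
  potential : ℝ → ℝ
  potential_continuousOn : ContinuousOn potential (Set.Icc 0 length)
  /-- the coupling matrix `U` -/
  coupling : Matrix (Fin 2 ⊕ Fin M) (Fin 2 ⊕ Fin M) ℂ
  coupling_mem_unitaryGroup : coupling ∈ Matrix.unitaryGroup (Fin 2 ⊕ Fin M) ℂ

namespace OneEdgeQuantumGraph

variable {M : ℕ} (Γ : OneEdgeQuantumGraph M)

/-! ### Resonances -/

/-- The momentum `k ≠ 0` is a resonance: there is a nonzero function on the graph which solves
`-(d/dx + i A)^2 f = k^2 f` on the internal edge, is the outgoing wave `x ↦ c j * exp (i k x)` on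
the `j`-th lead, and satisfies the coupling condition
`(U - 1) Ψ + i (U + 1) (Ψ' + i 𝒜 Ψ) = 0`, derivatives being taken in the outgoing direction.
Here `g = f' + i A f`, so that `Ψ' + i 𝒜 Ψ` has the entries `g 0`, `-g length` and `i k c j`. -/
def IsResonance (k : ℂ) : Prop :=
  k ≠ 0 ∧ ∃ (f g : ℝ → ℂ) (c : Fin M → ℂ),
    (∀ x ∈ Set.Icc 0 Γ.length,
      HasDerivWithinAt f (g x - I * Γ.potential x * f x) (Set.Icc 0 Γ.length) x) ∧
    (∀ x ∈ Set.Icc 0 Γ.length,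
      HasDerivWithinAt g (-k ^ 2 * f x - I * Γ.potential x * g x) (Set.Icc 0 Γ.length) x) ∧
    (Γ.coupling - 1) *ᵥ Sum.elim ![f 0, f Γ.length] c
      + I • ((Γ.coupling + 1) *ᵥ Sum.elim ![g 0, -g Γ.length] (fun j => I * k * c j)) = 0 ∧
    ((∃ x ∈ Set.Icc 0 Γ.length, f x ≠ 0) ∨ ∃ j, c j ≠ 0)

/-- The magnetic flux `Φ = ∫ A` along the internal edge. -/
def flux : ℝ := ∫ x in (0 : ℝ)..Γ.length, Γ.potential x

/-- The gauge matrix `diag (1, exp (i Φ), 1, …, 1)`. -/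
def gauge : Matrix (Fin 2 ⊕ Fin M) (Fin 2 ⊕ Fin M) ℂ :=
  Matrix.diagonal (Sum.elim ![1, Complex.exp (I * Γ.flux)] (fun _ => 1))

/-- The coupling matrix `U_A` after the magnetic potential has been gauged away. It equals `U`
when there is no magnetic field. -/
def gaugedCoupling : Matrix (Fin 2 ⊕ Fin M) (Fin 2 ⊕ Fin M) ℂ :=
  Γ.gauge * Γ.coupling * Γ.gauge⁻¹

/-- Boundary values of the functions `sin (k x)` and `cos (k x)` on the internal edge (first two
columns) and of `exp (i k x)` on the individual leads (the other columns). -/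
def boundaryValues (k : ℂ) : Matrix (Fin 2 ⊕ Fin M) (Fin 2 ⊕ Fin M) ℂ :=
  Matrix.fromBlocks
    !![0, 1; Complex.sin (k * Γ.length), Complex.cos (k * Γ.length)] 0 0 1

/-- Outgoing derivatives of the same functions at the boundary. -/
def boundaryDerivs (k : ℂ) : Matrix (Fin 2 ⊕ Fin M) (Fin 2 ⊕ Fin M) ℂ :=
  Matrix.fromBlocks
    !![k, 0; -k * Complex.cos (k * Γ.length), k * Complex.sin (k * Γ.length)] 0 0
    ((I * k) • (1 : Matrix (Fin M) (Fin M) ℂ))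

/-- The determinant of the linear system for the coefficients of an outgoing solution in the
functions above; an entire function of `k`, whose zeros `k ≠ 0` are the resonances. -/
def resonanceDet (k : ℂ) : ℂ :=
  ((Γ.gaugedCoupling - 1) * Γ.boundaryValues k
    + I • ((Γ.gaugedCoupling + 1) * Γ.boundaryDerivs k)).det

/-- The number `N(R)` of resonances `k` with `‖k‖ ≤ R`, counted with their algebraic
multiplicities, i.e. as zeros of the resonance determinant. -/
def resonanceCount (R : ℝ) : ℕ :=
  ∑ᶠ k ∈ {k : ℂ | Γ.IsResonance k ∧ ‖k‖ ≤ R}, analyticOrderNatAt Γ.resonanceDet k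

/-! ### Effective size and Weyl asymptotics -/

/-- `W` is the effective size of the graph: `N(R) = (2 / π) W R + O(1)` as `R → ∞`. -/
def HasEffectiveSize (W : ℝ) : Prop :=
  (fun R : ℝ => (Γ.resonanceCount R : ℝ) - 2 / Real.pi * W * R) =O[atTop] (fun _ => (1 : ℝ))

/-- The graph is Weyl: its effective size is the sum of the lengths of its internal edges. -/
def IsWeyl : Prop := Γ.HasEffectiveSize Γ.length

/-- The graph is non-Weyl. -/
def IsNonWeyl : Prop := ¬ Γ.IsWeyl

/-! ### The effective coupling matrix -/

/-- The matrix `(1 - k) U₄ - (k + 1)` to be inverted in the effective coupling matrix. -/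
def leadMatrix (k : ℂ) : Matrix (Fin M) (Fin M) ℂ :=
  (1 - k) • Γ.gaugedCoupling.toBlocks₂₂ - (k + 1) • (1 : Matrix (Fin M) (Fin M) ℂ)

/-- The effective coupling matrix
`Ũ(k) = U₁ - (1 - k) U₂ ((1 - k) U₄ - (k + 1))⁻¹ U₃`, a rational function of `k`; it is
meaningful at those `k` for which `leadMatrix k` is invertible. -/
def effectiveCoupling (k : ℂ) : Matrix (Fin 2) (Fin 2) ℂ :=
  Γ.gaugedCoupling.toBlocks₁₁
    - (1 - k) • (Γ.gaugedCoupling.toBlocks₁₂ * (Γ.leadMatrix k)⁻¹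
        * Γ.gaugedCoupling.toBlocks₂₁)

end OneEdgeQuantumGraph

end

/-!
Gauging the potential away turns the equation on the edge into `u'' = -k² u`, so an outgoing
solution is given by its coefficients at `sin kx`, `cos kx` and `exp (ikx)`, and the resonances are
the zeros `k ≠ 0` of the resonance determinant (`OneEdgeQuantumGraph.isResonance_iff`). Passing from
`sin kx`, `cos kx` to `exp (±ikx)` and expanding in the two columns of the edge, one finds that up
to a nonvanishing factor the determinant is
`P(k) e^{2ikl} + Q(k) e^{ikl} + W(k)` with polynomials `P`, `Q`, `W`
(`OneEdgeQuantumGraph.resonanceDet_eq`). Here `W = det ((1 - k) U_A - (1 + k))` is not the zero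
polynomial, because at `k = 1` the matrix is `-2`; and eliminating the leads by a Schur complement
gives `Q(k) = -4k det (leadMatrix k) (ũ₁₂(k) + ũ₂₁(k))`, so that the condition on the effective
coupling matrix says that `Q = 0` (`OneEdgeQuantumGraph.exists_exponential_polynomial`).

A graph of effective size `0` has a bounded counting function, hence finitely many resonances. An
exponential polynomial with finitely many zeros is `p(k) e^{ak}` with a polynomial `p`
(`HasExponentialType.exists_eq_polynomial_mul_exp`, through the Borel–Carathéodory and Liouville
theorems), and its growth along the imaginary axis shows that `P = Q = 0`
(`eq_zero_of_finite_zeros`).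

Conversely, let `Q = 0`. If `P ≠ 0`, then the number of zeros of `P e^{2ikl} + W` in the disk of
radius `R` is `2lR/π + O(1)` (`isBigO_zero_count`), so the graph is Weyl. Hence for a non-Weyl graph
`P = 0`, and the resonances are among the finitely many zeros of `W`. The counting is done in the
half-planes `±Re k ≥ T`: there `-W/P` has a holomorphic logarithm `L` with small derivative and
bounded imaginary part, the equation becomes `2ilk = L(k) + 2πin`, and by the contraction principle
it has at most one solution for every integer `n`, and exactly one for every large `n`, at distance
`2πn/(2l) + O(1)` from the origin.
-/

noncomputable section

/-! ### Growth and logarithms of complex polynomials -/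

/-- A property of nonzero complex polynomials that is multiplicative and holds for constants and
for monic linear factors holds for all of them. -/
@[elab_as_elim]
theorem Polynomial.induction_linear_factors {motive : Polynomial ℂ → Prop}
    (const : ∀ c : ℂ, c ≠ 0 → motive (.C c)) (linear : ∀ a : ℂ, motive (.X - .C a))
    (mul : ∀ p q, motive p → motive q → motive (p * q)) {p : Polynomial ℂ} (hp : p ≠ 0) :
    motive p := by
  rw [(IsAlgClosed.splits p).eq_prod_roots]
  refine mul _ _ (const _ (by simpa using hp)) ?_
  induction p.roots using Multiset.induction_on with
  | empty => simpa using const 1 one_ne_zero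
  | cons a s ih => simpa using mul _ _ (linear a) ih

/-- Outside a large disk `‖p z‖` lies between `exp (-B √‖z‖)` and `exp (B √‖z‖)`. The square root is
small enough for zeros with `|Im z| ≤ B √‖z‖` to satisfy `‖z‖ = |Re z| + O(1)`. -/
theorem Polynomial.exists_abs_log_norm_eval_le {p : Polynomial ℂ} (hp : p ≠ 0) :
    ∃ B R : ℝ, ∀ z : ℂ, R ≤ ‖z‖ → p.eval z ≠ 0 ∧ |Real.log ‖p.eval z‖| ≤ B * √‖z‖ := by
  refine Polynomial.induction_linear_factors (fun c hc => ?_) (fun a => ?_)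
    (fun p q hp hq => ?_) hp
  · refine ⟨|Real.log ‖c‖|, 1, fun z hz => ⟨by simpa using hc, ?_⟩⟩
    simp only [Polynomial.eval_C]
    exact le_mul_of_one_le_right (abs_nonneg _) (Real.one_le_sqrt.mpr hz)
  · refine ⟨4, ‖a‖ + 1, fun z hz => ?_⟩
    have h1 : 1 ≤ ‖z - a‖ := by linarith [norm_sub_norm_le z a]
    have h2 : ‖z - a‖ ≤ 2 * ‖z‖ := by linarith [norm_sub_le z a, norm_nonneg a]
    have h0 : (0 : ℝ) < ‖z - a‖ := by linarith
    refine ⟨by simpa [norm_pos_iff] using h0, ?_⟩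
    simp only [Polynomial.eval_sub, Polynomial.eval_X, Polynomial.eval_C]
    rw [abs_of_nonneg (Real.log_nonneg h1)]
    have h3 : Real.log ‖z - a‖ ≤ 2 * √‖z - a‖ := by
      have := Real.log_le_self (Real.sqrt_nonneg ‖z - a‖)
      rw [Real.log_sqrt h0.le] at this
      linarith
    have h4 : √‖z - a‖ ≤ 2 * √‖z‖ := by
      rw [Real.sqrt_le_left (by positivity), mul_pow, Real.sq_sqrt (norm_nonneg z)]
      linarith [norm_nonneg z]
    linarith
  · obtain ⟨B, R, h⟩ := hp
    obtain ⟨B', R', h'⟩ := hq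
    refine ⟨B + B', max R R', fun z hz => ?_⟩
    obtain ⟨h1, h2⟩ := h z (le_trans (le_max_left _ _) hz)
    obtain ⟨h3, h4⟩ := h' z (le_trans (le_max_right _ _) hz)
    refine ⟨by simp [h1, h3], ?_⟩
    rw [Polynomial.eval_mul, norm_mul, Real.log_mul (by simpa using h1) (by simpa using h3)]
    linarith [abs_add_le (Real.log ‖p.eval z‖) (Real.log ‖q.eval z‖)]

/-- On a right half-plane a polynomial has a holomorphic logarithm with bounded imaginary part and
with arbitrarily small derivative. -/
theorem Polynomial.exists_log {p : Polynomial ℂ} (hp : p ≠ 0) :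
    ∀ ε : ℝ, 0 < ε → ∃ (T B : ℝ) (L : ℂ → ℂ), ∀ z : ℂ, T ≤ z.re → exp (L z) = p.eval z ∧
      |(L z).im| ≤ B ∧ ∃ L', HasDerivAt L L' z ∧ ‖L'‖ ≤ ε := by
  refine Polynomial.induction_linear_factors (fun c hc => ?_) (fun a => ?_)
    (fun p q hp hq => ?_) hp
  · intro ε hε
    exact ⟨0, |(log c).im|, fun _ => log c, fun z _ => ⟨by simp [exp_log hc], le_rfl, 0,
      hasDerivAt_const _ _, by simpa using hε.le⟩⟩
  · intro ε hε
    refine ⟨a.re + ε⁻¹, Real.pi, fun z => log (z - a), fun z hz => ?_⟩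
    have h1 : ε⁻¹ ≤ (z - a).re := by rw [sub_re]; linarith
    have h2 : 0 < (z - a).re := (inv_pos.mpr hε).trans_le h1
    have h3 : z - a ≠ 0 := fun h => by simp [h] at h2
    refine ⟨by simp [exp_log h3], by simpa [log_im] using abs_arg_le_pi _, (z - a)⁻¹, ?_, ?_⟩
    · simpa using ((hasDerivAt_id z).sub_const a).clog (Or.inl h2)
    · rw [norm_inv]
      exact inv_le_of_inv_le₀ hε (h1.trans ((le_abs_self _).trans (abs_re_le_norm _)))
  · intro ε hε
    obtain ⟨T, B, L, h⟩ := hp (ε / 2) (half_pos hε)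
    obtain ⟨T', B', K, h'⟩ := hq (ε / 2) (half_pos hε)
    refine ⟨max T T', B + B', fun z => L z + K z, fun z hz => ?_⟩
    obtain ⟨h1, h2, L', h3, h4⟩ := h z (le_trans (le_max_left _ _) hz)
    obtain ⟨h5, h6, K', h7, h8⟩ := h' z (le_trans (le_max_right _ _) hz)
    refine ⟨by rw [exp_add, h1, h5, Polynomial.eval_mul], ?_, L' + K', h3.add h7, ?_⟩
    · rw [add_im]; exact (abs_add_le _ _).trans (add_le_add h2 h6)
    · linarith [norm_add_le L' K']

/-! ### Counting zeros of `P e^{icz} + Q` -/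

/-- The zeros of `P e^{icz} + Q` lie close to the real axis, because `e^{-c Im z} = ‖Q z‖ / ‖P z‖`
there. -/
theorem exists_abs_im_le_of_zero {P Q : Polynomial ℂ} (hP : P ≠ 0) (hQ : Q ≠ 0) {c : ℝ}
    (hc : 0 < c) : ∃ B R : ℝ, 0 ≤ B ∧ ∀ z : ℂ, R ≤ ‖z‖ →
      P.eval z * exp (I * c * z) + Q.eval z = 0 → |z.im| ≤ B * √‖z‖ := by
  obtain ⟨B, R, h⟩ := Polynomial.exists_abs_log_norm_eval_le hP
  obtain ⟨B', R', h'⟩ := Polynomial.exists_abs_log_norm_eval_le hQ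
  refine ⟨|B + B'| / c, max R R', by positivity, fun z hz h0 => ?_⟩
  obtain ⟨h1, h2⟩ := h z (le_trans (le_max_left _ _) hz)
  obtain ⟨h3, h4⟩ := h' z (le_trans (le_max_right _ _) hz)
  have h5 : ‖P.eval z‖ * Real.exp (-(c * z.im)) = ‖Q.eval z‖ := by
    have := congrArg norm (eq_neg_of_add_eq_zero_left h0)
    rwa [norm_neg, norm_mul, norm_exp, show (I * c * z).re = -(c * z.im) by simp] at this
  have h6 := congrArg Real.log h5
  rw [Real.log_mul (by simpa using h1) (Real.exp_ne_zero _), Real.log_exp] at h6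
  have h7 : c * |z.im| ≤ (B + B') * √‖z‖ := by
    rw [show c * |z.im| = |c * z.im| by rw [abs_mul, abs_of_pos hc],
      show c * z.im = Real.log ‖P.eval z‖ - Real.log ‖Q.eval z‖ by linarith]
    linarith [abs_sub (Real.log ‖P.eval z‖) (Real.log ‖Q.eval z‖)]
  rw [div_mul_eq_mul_div, le_div_iff₀ hc]
  nlinarith [le_abs_self (B + B'), Real.sqrt_nonneg ‖z‖]

/-- On a right half-plane `-Q / P` has a holomorphic logarithm with bounded imaginary part and
with arbitrarily small derivative. -/
theorem exists_log_neg_div {P Q : Polynomial ℂ} (hP : P ≠ 0) (hQ : Q ≠ 0) {ε : ℝ} (hε : 0 < ε) :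
    ∃ (T B : ℝ) (L : ℂ → ℂ), ∀ z : ℂ, T ≤ z.re → P.eval z ≠ 0 ∧
      P.eval z * exp (L z) = -Q.eval z ∧ |(L z).im| ≤ B ∧ ∃ L', HasDerivAt L L' z ∧ ‖L'‖ ≤ ε := by
  obtain ⟨T, B, L, h⟩ := Polynomial.exists_log hP (ε / 2) (half_pos hε)
  obtain ⟨T', B', K, h'⟩ := Polynomial.exists_log (neg_ne_zero.mpr hQ) (ε / 2) (half_pos hε)
  refine ⟨max T T', B + B', fun z => K z - L z, fun z hz => ?_⟩
  obtain ⟨h1, h2, L', h3, h4⟩ := h z (le_trans (le_max_left _ _) hz)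
  obtain ⟨h5, h6, K', h7, h8⟩ := h' z (le_trans (le_max_right _ _) hz)
  refine ⟨h1 ▸ exp_ne_zero _, ?_, ?_, K' - L', h7.sub h3, ?_⟩
  · rw [exp_sub, h1, h5, Polynomial.eval_neg]
    field_simp [show P.eval z ≠ 0 from h1 ▸ exp_ne_zero _]
  · rw [sub_im]; linarith [abs_sub (K z).im (L z).im]
  · linarith [norm_sub_le K' L']

theorem Int.sub_sub_one_le_card_Icc (a b : ℝ) :
    b - a - 1 ≤ ((Finset.Icc ⌈a⌉ ⌊b⌋).card : ℝ) := by
  rw [Int.card_Icc]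
  have h : ((⌊b⌋ + 1 - ⌈a⌉ : ℤ) : ℝ) ≤ (((⌊b⌋ + 1 - ⌈a⌉).toNat : ℤ) : ℝ) :=
    Int.cast_le.mpr (Int.self_le_toNat _)
  push_cast at h
  linarith [Int.lt_floor_add_one b, Int.ceil_lt_add_one a]

theorem Int.card_Icc_le_max (a b : ℝ) :
    ((Finset.Icc ⌈a⌉ ⌊b⌋).card : ℝ) ≤ max (b - a + 1) 0 := by
  rw [Int.card_Icc, ← Int.cast_natCast, Int.toNat_eq_max]
  push_cast
  refine max_le_max ?_ le_rfl
  linarith [Int.floor_le b, Int.le_ceil a]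

/-- The zeros of `P e^{icz} + Q` in a right half-plane are simple: with a logarithm `L` of `-Q / P`
the derivative at a zero is `P e^L (ic - L')`, and `L'` is small. -/
theorem exists_deriv_ne_zero_of_zero {P Q : Polynomial ℂ} (hP : P ≠ 0) (hQ : Q ≠ 0) {c : ℝ}
    (hc : 0 < c) : ∃ T : ℝ, ∀ z : ℂ, T ≤ z.re → P.eval z * exp (I * c * z) + Q.eval z = 0 →
      deriv (fun z => P.eval z * exp (I * c * z) + Q.eval z) z ≠ 0 := by
  obtain ⟨T, B, L, h⟩ := exists_log_neg_div hP hQ (half_pos hc)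
  refine ⟨T + 1, fun z hz h0 => ?_⟩
  obtain ⟨h1, h2, -, L', h3, h4⟩ := h z (by linarith)
  have hE : exp (I * c * z) = exp (L z) := by
    have : P.eval z * exp (I * c * z) = P.eval z * exp (L z) := by
      rw [h2]; exact eq_neg_of_add_eq_zero_left h0
    exact mul_left_cancel₀ h1 this
  have hev : (fun w => P.eval w * exp (L w)) =ᶠ[nhds z] fun w => -Q.eval w := by
    have : ∀ᶠ w : ℂ in nhds z, T < w.re :=
      continuous_re.continuousAt.eventually (lt_mem_nhds (by linarith))
    filter_upwards [this] with w hw using (h w hw.le).2.1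
  have hd1 := ((P.hasDerivAt z).mul h3.cexp).unique
    ((Q.hasDerivAt z).neg.congr_of_eventuallyEq hev)
  have hlin : HasDerivAt (fun z : ℂ => I * c * z) (I * c) z := by
    simpa using (hasDerivAt_id z).const_mul (I * (c : ℂ))
  have hd2 := ((P.hasDerivAt z).mul hlin.cexp).add (Q.hasDerivAt z)
  have hd : deriv (fun z => P.eval z * exp (I * c * z) + Q.eval z) z
      = P.eval z * exp (L z) * (I * c - L') := by
    rw [show Q.derivative.eval z = -(P.derivative.eval z * exp (L z)
      + P.eval z * (exp (L z) * L')) by rw [hd1]; ring] at hd2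
    rw [hE] at hd2
    refine (HasDerivAt.deriv hd2).trans ?_
    ring
  rw [hd]
  refine mul_ne_zero (mul_ne_zero h1 (exp_ne_zero _)) fun h5 => ?_
  rw [← sub_eq_zero.mp h5] at h4
  simp [abs_of_pos hc] at h4
  linarith

/-- Zeros of `P e^{icz} + Q` in a right half-plane correspond to integers `n` through
`icz = L z + 2πin`, `L` being a logarithm of `-Q / P`: this equation has at most one solution for
each `n`, and exactly one for large `n`, by the contraction principle. -/
theorem exists_ncard_right_zeros {P Q : Polynomial ℂ} (hP : P ≠ 0) (hQ : Q ≠ 0) {c : ℝ}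
    (hc : 0 < c) : ∃ T₀ : ℝ, ∀ T, T₀ ≤ T → ∃ C, ∀ R : ℝ, 0 ≤ R →
      {z : ℂ | (T ≤ z.re ∧ ‖z‖ ≤ R) ∧ P.eval z * exp (I * c * z) + Q.eval z = 0}.Finite ∧
      |({z : ℂ | (T ≤ z.re ∧ ‖z‖ ≤ R) ∧
          P.eval z * exp (I * c * z) + Q.eval z = 0}.ncard : ℝ) - c / (2 * Real.pi) * R| ≤ C := by
  obtain ⟨T₁, B, L, hL⟩ := exists_log_neg_div hP hQ (half_pos hc)
  obtain ⟨B₁, R₁, hB₁, hIm⟩ := exists_abs_im_le_of_zero hP hQ hc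
  refine ⟨max T₁ (max R₁ 1), fun T hT => ?_⟩
  have hT₁ : T₁ ≤ T := (le_max_left _ _).trans hT
  have hR₁ : R₁ ≤ T := ((le_max_left _ _).trans (le_max_right _ _)).trans hT
  have h1T : 1 ≤ T := ((le_max_right _ _).trans (le_max_right _ _)).trans hT
  set F : ℂ → ℂ := fun z => P.eval z * exp (I * c * z) + Q.eval z with hF
  have hpi := Real.pi_pos
  -- zeros in the half-plane solve the logarithmic equation for some integer
  have hzero : ∀ z : ℂ, T ≤ z.re → (F z = 0 ↔ ∃ n : ℤ, I * c * z = L z + n * (2 * Real.pi * I)) := by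
    intro z hz
    obtain ⟨h1, h2, -⟩ := hL z (hT₁.trans hz)
    rw [← exp_eq_exp_iff_exists_int, hF]
    constructor
    · intro h
      refine mul_left_cancel₀ h1 ?_
      rw [h2]; exact eq_neg_of_add_eq_zero_left h
    · intro h
      simp only [h, h2]; ring
  have him : ∀ (z : ℂ) (n : ℤ), I * c * z = L z + n * (2 * Real.pi * I) →
      c * z.re = (L z).im + n * (2 * Real.pi) := by
    intro z n h
    simpa using congrArg Complex.im h
  have hLip : ∀ z w : ℂ, T ≤ z.re → T ≤ w.re → ‖L z - L w‖ ≤ c / 2 * ‖z - w‖ := by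
    intro z w hz hw
    refine (convex_halfSpace_re_ge T).norm_image_sub_le_of_norm_deriv_le (𝕜 := ℂ) (f := L)
      (fun x hx => ?_) (fun x hx => ?_) hw hz
    · obtain ⟨-, -, -, L', h, -⟩ := hL x (hT₁.trans hx)
      exact h.differentiableAt
    · obtain ⟨-, -, -, L', h, h'⟩ := hL x (hT₁.trans hx)
      rwa [h.deriv]
  have hinj : ∀ (z w : ℂ) (n : ℤ), T ≤ z.re → T ≤ w.re → I * c * z = L z + n * (2 * Real.pi * I) →
      I * c * w = L w + n * (2 * Real.pi * I) → z = w := by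
    intro z w n hz hw h h'
    have h1 : I * c * (z - w) = L z - L w := by linear_combination h - h'
    have h2 := hLip z w hz hw
    rw [← h1, norm_mul] at h2
    simp only [norm_mul, norm_I, one_mul, norm_real, Real.norm_eq_abs, abs_of_pos hc] at h2
    have h3 : ‖z - w‖ ≤ 0 := by
      by_contra! h3
      nlinarith [mul_pos hc h3]
    exact sub_eq_zero.mp (norm_le_zero_iff.mp h3)
  set K : ℝ := B₁ ^ 2
  have hnorm : ∀ z : ℂ, T ≤ z.re → F z = 0 → ‖z‖ ≤ z.re + K := by
    intro z hz h0
    have hz0 : z.re ≤ ‖z‖ := (le_abs_self _).trans (abs_re_le_norm _)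
    have h1 := hIm z (by linarith) h0
    have h2 : z.im ^ 2 ≤ K * ‖z‖ := by
      rw [← sq_abs]
      calc |z.im| ^ 2 ≤ (B₁ * √‖z‖) ^ 2 := by gcongr
        _ = K * ‖z‖ := by rw [mul_pow, Real.sq_sqrt (norm_nonneg z)]
    have h3 : ‖z‖ ^ 2 = z.re ^ 2 + z.im ^ 2 := by
      rw [Complex.sq_norm, normSq_apply]; ring
    have h4 : 0 ≤ K := sq_nonneg _
    nlinarith
  have hex : ∀ n : ℤ, (c * T + B) / (2 * Real.pi) ≤ n → ∃ z : ℂ, T ≤ z.re ∧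
      I * c * z = L z + n * (2 * Real.pi * I) := by
    intro n hn
    rw [div_le_iff₀ (by positivity)] at hn
    set S : Set ℂ := {z | T ≤ z.re}
    -- the solutions are the fixed points of a contraction of the half-plane
    set φ : ℂ → ℂ := fun z => -I / c * (L z + n * (2 * Real.pi * I)) with hφ
    have hc' : (c : ℂ) ≠ 0 := by exact_mod_cast hc.ne'
    have hφre : ∀ z, c * (φ z).re = (L z).im + n * (2 * Real.pi) := by
      intro z
      have : (c : ℂ) * φ z = -I * (L z + n * (2 * Real.pi * I)) := by
        rw [hφ]; field_simp
      simpa using congrArg Complex.re this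
    have hmaps : Set.MapsTo φ S S := by
      intro z hz
      have h1 := (hL z (hT₁.trans hz)).2.2.1
      have h2 := hφre z
      have h3 := neg_abs_le (L z).im
      change T ≤ (φ z).re
      refine le_of_mul_le_mul_left ?_ hc
      linarith
    have hcomplete : IsComplete S := (isClosed_le continuous_const continuous_re).isComplete
    have hcontr : ContractingWith (1 / 2) (hmaps.restrict φ S S) := by
      refine ⟨by norm_num, LipschitzWith.of_dist_le_mul fun z w => ?_⟩
      rw [Subtype.dist_eq, Subtype.dist_eq, dist_eq_norm, dist_eq_norm]
      simp only [Set.MapsTo.val_restrict_apply, hφ]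
      rw [← mul_sub, add_sub_add_right_eq_sub, norm_mul]
      have := hLip z w z.2 w.2
      rw [show ‖-I / (c : ℂ)‖ = c⁻¹ by simp [abs_of_pos hc]]
      calc c⁻¹ * ‖L z - L w‖ ≤ c⁻¹ * (c / 2 * ‖(z : ℂ) - w‖) := by gcongr
        _ = _ := by push_cast; field_simp
    obtain ⟨z, hzS, hfix, -⟩ := hcontr.exists_fixedPoint' hcomplete hmaps
      (x := (T : ℂ)) (by simp [S]) (edist_ne_top _ _)
    refine ⟨z, hzS, ?_⟩
    have h1 : -I / c * (L z + n * (2 * Real.pi * I)) = z := hfix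
    conv_lhs => rw [← h1]
    field_simp
    rw [I_sq]; ring
  -- the integer belonging to a zero
  set M : ℂ → ℤ := fun z => ⌊(c * z.re - (L z).im) / (2 * Real.pi)⌋ with hM
  have hMn : ∀ (z : ℂ) (n : ℤ), I * c * z = L z + n * (2 * Real.pi * I) → M z = n := by
    intro z n h
    have : (c * z.re - (L z).im) / (2 * Real.pi) = n := by
      rw [him z n h]; field_simp; ring
    simp only [hM, this, Int.floor_intCast]
  refine ⟨c * T / (2 * Real.pi) + c * K / (2 * Real.pi) + |B| / Real.pi + 1, fun R hR => ?_⟩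
  set S : Set ℂ := {z : ℂ | (T ≤ z.re ∧ ‖z‖ ≤ R) ∧ F z = 0} with hS
  have hMinj : Set.InjOn M S := by
    rintro z ⟨⟨hz, -⟩, hz0⟩ w ⟨⟨hw, -⟩, hw0⟩ h
    obtain ⟨n, hn⟩ := (hzero z hz).mp hz0
    obtain ⟨m, hm⟩ := (hzero w hw).mp hw0
    rw [hMn z n hn, hMn w m hm] at h
    subst h
    exact hinj z w n hz hw hn hm
  have hup : M '' S ⊆ Finset.Icc ⌈(c * T - B) / (2 * Real.pi)⌉ ⌊(c * R + B) / (2 * Real.pi)⌋ := by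
    rintro _ ⟨z, ⟨⟨hz, hzR⟩, hz0⟩, rfl⟩
    obtain ⟨n, hn⟩ := (hzero z hz).mp hz0
    rw [hMn z n hn]
    have h1 := him z n hn
    have h2 := abs_le.mp (hL z (hT₁.trans hz)).2.2.1
    have h3 : z.re ≤ R := ((le_abs_self _).trans (abs_re_le_norm _)).trans hzR
    have h4 := mul_le_mul_of_nonneg_left h3 hc.le
    have h5 := mul_le_mul_of_nonneg_left hz hc.le
    rw [Finset.coe_Icc, Set.mem_Icc, Int.ceil_le, Int.le_floor, div_le_iff₀ (by positivity),
      le_div_iff₀ (by positivity)]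
    constructor <;> linarith
  have hlow : ((Finset.Icc ⌈(c * T + B) / (2 * Real.pi)⌉
      ⌊(c * (R - K) - B) / (2 * Real.pi)⌋ : Finset ℤ) : Set ℤ) ⊆ M '' S := by
    intro n hn
    rw [Finset.coe_Icc, Set.mem_Icc, Int.ceil_le, Int.le_floor, le_div_iff₀ (by positivity)] at hn
    obtain ⟨z, hz, hzn⟩ := hex n hn.1
    have hz0 : F z = 0 := (hzero z hz).mpr ⟨n, hzn⟩
    refine ⟨z, ⟨⟨hz, ?_⟩, hz0⟩, hMn z n hzn⟩
    have h1 := him z n hzn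
    have h2 := abs_le.mp (hL z (hT₁.trans hz)).2.2.1
    have h3 := hnorm z hz hz0
    have : c * z.re ≤ c * (R - K) := by linarith
    linarith [le_of_mul_le_mul_left this hc]
  have hfin : (M '' S).Finite := (Finset.finite_toSet _).subset hup
  refine ⟨Set.Finite.of_finite_image hfin hMinj, ?_⟩
  rw [← hMinj.ncard_image]
  have h1 := Set.ncard_le_ncard hup (Finset.finite_toSet _)
  have h2 := Set.ncard_le_ncard hlow hfin
  rw [Set.ncard_coe_finset] at h1
  rw [Set.ncard_coe_finset] at h2
  have h1' := (Nat.cast_le (α := ℝ).mpr h1).trans (Int.card_Icc_le_max _ _)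
  have h2' := (Int.sub_sub_one_le_card_Icc _ _).trans (Nat.cast_le (α := ℝ).mpr h2)
  have e1 : (c * R + B) / (2 * Real.pi) - (c * T - B) / (2 * Real.pi)
      = c / (2 * Real.pi) * R - c * T / (2 * Real.pi) + B / Real.pi := by field_simp; ring
  have e2 : (c * (R - K) - B) / (2 * Real.pi) - (c * T + B) / (2 * Real.pi)
      = c / (2 * Real.pi) * R - c * T / (2 * Real.pi) - c * K / (2 * Real.pi) - B / Real.pi := by
    field_simp; ring
  rw [e1] at h1'
  rw [e2] at h2'
  have p1 : 0 ≤ c / (2 * Real.pi) * R := by positivity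
  have p2 : 0 ≤ c * T / (2 * Real.pi) := by positivity
  have p3 : 0 ≤ c * K / (2 * Real.pi) := by positivity
  have p4 : B / Real.pi ≤ |B| / Real.pi := by gcongr; exact le_abs_self B
  have p5 : 0 ≤ |B| / Real.pi := by positivity
  rw [abs_le]
  constructor
  · linarith
  · rcases max_cases (c / (2 * Real.pi) * R - c * T / (2 * Real.pi) + B / Real.pi + 1) 0 with
      h | h <;> linarith

theorem finite_zeros_in_closedBall {f : ℂ → ℂ} (hf : Differentiable ℂ f) {a : ℂ} (ha : f a ≠ 0)
    (R : ℝ) : {z : ℂ | f z = 0 ∧ ‖z‖ ≤ R}.Finite := by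
  have h1 : f ⁻¹' {0}ᶜ ∈ codiscreteWithin (Metric.closedBall (0 : ℂ) R) :=
    codiscreteWithin_mono (Set.subset_univ _)
      (AnalyticOnNhd.preimage_zero_mem_codiscrete (fun z _ => hf.analyticAt z) ha)
  refine ((isCompact_closedBall (0 : ℂ) R).finite_sdiff_of_mem_codiscreteWithin h1).subset ?_
  rintro z ⟨hz, hR⟩
  exact ⟨by simpa using hR, by simpa using hz⟩

theorem finsum_mem_le_finsum_mem_of_subset {α : Type*} {s t : Set α} (hst : s ⊆ t) (ht : t.Finite)
    (f : α → ℕ) : ∑ᶠ x ∈ s, f x ≤ ∑ᶠ x ∈ t, f x := by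
  rw [finsum_mem_eq_finite_toFinset_sum f ht, finsum_mem_eq_finite_toFinset_sum f (ht.subset hst)]
  exact Finset.sum_le_sum_of_subset (by simpa using hst)

/-- The number of nonzero zeros of `P e^{icz} + Q` in the disk of radius `R`, with multiplicities,
is `cR/π + O(1)`. -/
theorem isBigO_zero_count {P Q : Polynomial ℂ} (hP : P ≠ 0) (hQ : Q ≠ 0) {c : ℝ} (hc : 0 < c) :
    (fun R : ℝ => ((∑ᶠ z ∈ {z : ℂ | (z ≠ 0 ∧ P.eval z * exp (I * c * z) + Q.eval z = 0) ∧ ‖z‖ ≤ R},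
      analyticOrderNatAt (fun z => P.eval z * exp (I * c * z) + Q.eval z) z : ℕ) : ℝ)
        - c / Real.pi * R) =O[atTop] (fun _ => (1 : ℝ)) := by
  -- the substitution `z ↦ -z` exchanges the roles of the two polynomials
  set P' : Polynomial ℂ := P.comp (-.X) with hP'
  set Q' : Polynomial ℂ := Q.comp (-.X) with hQ'
  have hcomp : ∀ p : Polynomial ℂ, p ≠ 0 → p.comp (-.X) ≠ 0 := by
    intro p hp h
    apply hp
    have := congrArg (fun q : Polynomial ℂ => q.comp (-.X)) h
    simpa [Polynomial.comp_assoc] using this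
  set F : ℂ → ℂ := fun z => P.eval z * exp (I * c * z) + Q.eval z with hF
  set G : ℂ → ℂ := fun z => Q'.eval z * exp (I * c * z) + P'.eval z with hG
  have hFG : ∀ z, F z = exp (I * c * z) * G (-z) := by
    intro z
    simp only [hF, hG, hP', hQ', Polynomial.eval_comp, Polynomial.eval_neg, Polynomial.eval_X,
      neg_neg, mul_add]
    rw [show exp (I * c * z) * (Q.eval z * exp (I * c * -z))
      = Q.eval z * (exp (I * c * z) * exp (I * c * -z)) by ring, ← exp_add]
    simp; ring
  have hdiffF : Differentiable ℂ F := by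
    have := P.differentiable; have := Q.differentiable
    simp only [hF]; fun_prop
  have hdiffG : Differentiable ℂ G := by
    have := P'.differentiable; have := Q'.differentiable
    simp only [hG]; fun_prop
  obtain ⟨T₁, h₁⟩ := exists_ncard_right_zeros hP hQ hc
  obtain ⟨T₂, h₂⟩ := exists_ncard_right_zeros (hcomp Q hQ) (hcomp P hP) hc
  obtain ⟨T₃, h₃⟩ := exists_deriv_ne_zero_of_zero hP hQ hc
  obtain ⟨T₄, h₄⟩ := exists_deriv_ne_zero_of_zero (hcomp Q hQ) (hcomp P hP) hc
  obtain ⟨T, hT⟩ : ∃ T : ℝ, T₁ ≤ T ∧ T₂ ≤ T ∧ T₃ ≤ T ∧ T₄ ≤ T ∧ 1 ≤ T := by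
    have : ∀ᶠ T : ℝ in atTop, T₁ ≤ T ∧ T₂ ≤ T ∧ T₃ ≤ T ∧ T₄ ≤ T ∧ 1 ≤ T := by
      filter_upwards [eventually_ge_atTop T₁, eventually_ge_atTop T₂, eventually_ge_atTop T₃,
        eventually_ge_atTop T₄, eventually_ge_atTop 1] with T a b c d e using ⟨a, b, c, d, e⟩
    exact this.exists
  obtain ⟨hT₁, hT₂, hT₃, hT₄, hT1⟩ := hT
  obtain ⟨C₁, h₁⟩ := h₁ T hT₁
  obtain ⟨C₂, h₂⟩ := h₂ T hT₂
  have hord1 : ∀ z : ℂ, T ≤ z.re → F z = 0 → analyticOrderNatAt F z = 1 := by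
    intro z hz h0
    have := (hdiffF.analyticAt z).analyticOrderAt_eq_one_of_zero_deriv_ne_zero h0
      (h₃ z (hT₃.trans hz) h0)
    simp [analyticOrderNatAt, this]
  have hord2 : ∀ z : ℂ, z.re ≤ -T → F z = 0 → analyticOrderNatAt F z = 1 := by
    intro z hz h0
    have hG0 : G (-z) = 0 := by
      have := hFG z
      rw [h0] at this
      simpa using this.symm
    have hd : deriv F z ≠ 0 := by
      have e1 : HasDerivAt (fun z : ℂ => exp (I * c * z)) (exp (I * c * z) * (I * c)) z := by
        simpa using ((hasDerivAt_id z).const_mul (I * (c : ℂ))).cexp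
      have e2 : HasDerivAt (fun z : ℂ => G (-z)) (-deriv G (-z)) z := by
        simpa [Function.comp_def] using
          (hdiffG (-z)).hasDerivAt.scomp z (hasDerivAt_neg z)
      have e3 := e1.mul e2
      have e4 : F = (fun z : ℂ => exp (I * c * z)) * fun z => G (-z) := funext hFG
      rw [e4, e3.deriv, hG0]
      have h5 : deriv G (-z) ≠ 0 := h₄ (-z) (by rw [neg_re]; linarith) hG0
      simpa using h5
    have := (hdiffF.analyticAt z).analyticOrderAt_eq_one_of_zero_deriv_ne_zero h0 hd
    simp [analyticOrderNatAt, this]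
  obtain ⟨a, ha⟩ : ∃ a, F a ≠ 0 := by
    by_contra! h
    have h0 : F = fun _ => 0 := funext h
    refine h₃ T (by simpa using hT₃) (h T) ?_
    change deriv F _ = 0
    rw [h0]; simp
  -- the zeros in a vertical strip are bounded
  have hMfin : {z : ℂ | (z ≠ 0 ∧ F z = 0) ∧ |z.re| < T}.Finite := by
    obtain ⟨B, R₀, hB, him⟩ := exists_abs_im_le_of_zero hP hQ hc
    refine (finite_zeros_in_closedBall hdiffF ha (max (max R₀ 1) ((T + B) ^ 2))).subset ?_
    rintro z ⟨⟨-, h0⟩, hre⟩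
    refine ⟨h0, ?_⟩
    by_contra! hlt
    obtain ⟨h5, h6⟩ := max_lt_iff.mp hlt
    obtain ⟨h7, h8⟩ := max_lt_iff.mp h5
    have h9 := him z h7.le h0
    have h10 : 1 ≤ √‖z‖ := Real.one_le_sqrt.mpr h8.le
    have h11 := Real.sq_sqrt (norm_nonneg z)
    have h12 : ‖z‖ ≤ (T + B) * √‖z‖ := by
      calc ‖z‖ ≤ |z.re| + |z.im| := norm_le_abs_re_add_abs_im z
        _ ≤ T * 1 + B * √‖z‖ := by linarith
        _ ≤ T * √‖z‖ + B * √‖z‖ := by gcongr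
        _ = _ := by ring
    have h13 : √‖z‖ ≤ T + B := by
      by_contra! h
      nlinarith
    have : ‖z‖ ≤ (T + B) ^ 2 := by rw [← h11]; gcongr
    linarith
  set K : ℕ := ∑ᶠ z ∈ {z : ℂ | (z ≠ 0 ∧ F z = 0) ∧ |z.re| < T}, analyticOrderNatAt F z
  refine IsBigO.of_bound (C₁ + C₂ + K) ?_
  filter_upwards [eventually_ge_atTop 0] with R hR
  obtain ⟨hAfin, hA⟩ := h₁ R hR
  obtain ⟨hBfin, hB⟩ := h₂ R hR
  set SA : Set ℂ := {z | (T ≤ z.re ∧ ‖z‖ ≤ R) ∧ F z = 0} with hSA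
  set SB : Set ℂ := {z | (T ≤ z.re ∧ ‖z‖ ≤ R) ∧ G z = 0} with hSB
  set SB' : Set ℂ := (fun z => -z) '' SB with hSB'
  set SM : Set ℂ := {z | ((z ≠ 0 ∧ F z = 0) ∧ |z.re| < T) ∧ ‖z‖ ≤ R} with hSM
  have hBmem : ∀ z, z ∈ SB' ↔ (z.re ≤ -T ∧ ‖z‖ ≤ R) ∧ F z = 0 := by
    intro z
    simp only [hSB', hSB, Set.mem_image, Set.mem_ofPred_eq]
    constructor
    · rintro ⟨w, ⟨⟨hw1, hw2⟩, hw3⟩, rfl⟩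
      refine ⟨⟨by rw [neg_re]; linarith, by simpa using hw2⟩, ?_⟩
      rw [hFG, neg_neg, hw3, mul_zero]
    · rintro ⟨⟨hw1, hw2⟩, hw3⟩
      refine ⟨-z, ⟨⟨by rw [neg_re]; linarith, by simpa using hw2⟩, ?_⟩, neg_neg z⟩
      have := hFG z
      rw [hw3] at this
      simpa using this.symm
  have hunion : {z : ℂ | (z ≠ 0 ∧ F z = 0) ∧ ‖z‖ ≤ R} = (SA ∪ SB') ∪ SM := by
    ext z
    simp only [Set.mem_union, hBmem, hSA, hSM, Set.mem_ofPred_eq]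
    constructor
    · rintro ⟨⟨h1, h2⟩, h3⟩
      by_cases h4 : |z.re| < T
      · exact Or.inr ⟨⟨⟨h1, h2⟩, h4⟩, h3⟩
      · left
        rcases le_abs.mp (not_lt.mp h4) with h5 | h5
        · exact Or.inl ⟨⟨h5, h3⟩, h2⟩
        · exact Or.inr ⟨⟨by linarith, h3⟩, h2⟩
    · rintro ((⟨⟨h1, h2⟩, h3⟩ | ⟨⟨h1, h2⟩, h3⟩) | h)
      · refine ⟨⟨?_, h3⟩, h2⟩
        rintro rfl
        simp at h1; linarith
      · refine ⟨⟨?_, h3⟩, h2⟩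
        rintro rfl
        simp at h1; linarith
      · exact ⟨h.1.1, h.2⟩
  have hdisj1 : Disjoint SA SB' := by
    rw [Set.disjoint_left]
    rintro z hz hz'
    have h1 := hz.1.1
    have h2 := ((hBmem z).mp hz').1.1
    linarith
  have hdisj2 : Disjoint (SA ∪ SB') SM := by
    rw [Set.disjoint_left]
    rintro z hz hz'
    have h3 := abs_lt.mp hz'.1.2
    rcases hz with h | h
    · linarith [h.1.1]
    · linarith [((hBmem z).mp h).1.1]
  have hB'fin : SB'.Finite := hBfin.image _
  have hSMsub : SM ⊆ {z : ℂ | (z ≠ 0 ∧ F z = 0) ∧ |z.re| < T} := fun z hz => hz.1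
  have hsumA : ∑ᶠ z ∈ SA, analyticOrderNatAt F z = SA.ncard := by
    rw [← finsum_one]
    exact finsum_mem_congr rfl fun z hz => hord1 z hz.1.1 hz.2
  have hsumB : ∑ᶠ z ∈ SB', analyticOrderNatAt F z = SB.ncard := by
    rw [← Set.InjOn.ncard_image (f := fun z : ℂ => -z) neg_injective.injOn, ← finsum_one]
    exact finsum_mem_congr rfl fun z hz => hord2 z ((hBmem z).mp hz).1.1 ((hBmem z).mp hz).2
  have hsumM : ∑ᶠ z ∈ SM, analyticOrderNatAt F z ≤ K :=
    finsum_mem_le_finsum_mem_of_subset hSMsub hMfin _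
  change ‖((∑ᶠ z ∈ {z : ℂ | (z ≠ 0 ∧ F z = 0) ∧ ‖z‖ ≤ R}, analyticOrderNatAt F z : ℕ) : ℝ)
    - c / Real.pi * R‖ ≤ _
  rw [hunion, finsum_mem_union hdisj2 (hAfin.union hB'fin) (hMfin.subset hSMsub),
    finsum_mem_union hdisj1 hAfin hB'fin, hsumA, hsumB]
  have hsumM' := Nat.cast_le (α := ℝ).mpr hsumM
  have hsumM0 : (0 : ℝ) ≤ ((∑ᶠ z ∈ SM, analyticOrderNatAt F z : ℕ) : ℝ) := Nat.cast_nonneg _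
  have e : c / Real.pi * R = c / (2 * Real.pi) * R + c / (2 * Real.pi) * R := by
    field_simp; ring
  push_cast at *
  rw [e, Real.norm_eq_abs, norm_one, mul_one]
  rw [abs_le] at *
  constructor <;> linarith [hA.1, hA.2, hB.1, hB.2]

/-! ### Entire functions of exponential type with finitely many zeros -/

/-- An entire function of exponential type, with a single constant for the exponent and for the
factor in front of the exponential. -/
def HasExponentialType (f : ℂ → ℂ) : Prop :=
  Differentiable ℂ f ∧ ∃ C : ℝ, ∀ z, ‖f z‖ ≤ Real.exp (C * (1 + ‖z‖))

theorem HasExponentialType.dslope {f : ℂ → ℂ} (hf : HasExponentialType f) {a : ℂ} (ha : f a = 0) :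
    HasExponentialType (dslope f a) := by
  obtain ⟨hd, C, hC⟩ := hf
  have hdd : Differentiable ℂ (_root_.dslope f a) := by
    rw [← differentiableOn_univ, Complex.differentiableOn_dslope univ_mem, differentiableOn_univ]
    exact hd
  refine ⟨hdd, ?_⟩
  obtain ⟨K, hK⟩ := (isCompact_closedBall a 1).exists_bound_of_continuousOn
    hdd.continuous.continuousOn
  refine ⟨max C (max 0 (Real.log (max K 1))), fun z => ?_⟩
  set C' := max C (max 0 (Real.log (max K 1)))
  have hC0 : 0 ≤ C' := (le_max_left _ _).trans (le_max_right _ _)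
  by_cases hz : z ∈ Metric.closedBall a 1
  · calc ‖_root_.dslope f a z‖ ≤ max K 1 := (hK z hz).trans (le_max_left _ _)
      _ = Real.exp (Real.log (max K 1)) := (Real.exp_log (by positivity)).symm
      _ ≤ Real.exp (C' * (1 + ‖z‖)) := by
        rw [Real.exp_le_exp]
        have : Real.log (max K 1) ≤ C' := (le_max_right _ _).trans (le_max_right _ _)
        nlinarith [norm_nonneg z]
  · rw [Metric.mem_closedBall, not_le, dist_eq_norm] at hz
    have hza : z ≠ a := by rintro rfl; simp at hz; linarith
    rw [dslope_of_ne _ hza, slope_def_field, ha, sub_zero, norm_div]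
    calc ‖f z‖ / ‖z - a‖ ≤ ‖f z‖ := div_le_self (norm_nonneg _) hz.le
      _ ≤ _ := hC z
      _ ≤ _ := by
        rw [Real.exp_le_exp]
        have : C ≤ C' := le_max_left _ _
        gcongr

theorem HasExponentialType.exists_eq_pow_mul {f : ℂ → ℂ} (hf : HasExponentialType f) {b : ℂ}
    (hb : f b ≠ 0) (a : ℂ) : ∃ (n : ℕ) (g : ℂ → ℂ), HasExponentialType g ∧ g a ≠ 0 ∧
      ∀ z, f z = (z - a) ^ n * g z := by
  have htop : analyticOrderAt f a ≠ ⊤ := by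
    rw [Ne, AnalyticOnNhd.analyticOrderAt_eq_top_iff_eq_zero a fun z => hf.1.analyticAt z]
    rintro rfl
    simp at hb
  obtain ⟨n, hn⟩ := ENat.ne_top_iff_exists.mp htop
  induction n generalizing f with
  | zero =>
    refine ⟨0, f, hf, ?_, by simp⟩
    exact (hf.1.analyticAt a).analyticOrderAt_eq_zero.mp (by simpa using hn.symm)
  | succ n ih =>
    have ha : f a = 0 := apply_eq_zero_of_analyticOrderAt_ne_zero (by rw [← hn]; simp)
    have hg := hf.dslope ha
    have hfac : ∀ z, f z = (z - a) * _root_.dslope f a z := by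
      intro z
      have := sub_smul_dslope f a z
      rw [ha, sub_zero, smul_eq_mul] at this
      exact this.symm
    have hord : analyticOrderAt f a = 1 + analyticOrderAt (_root_.dslope f a) a := by
      conv_lhs => rw [show f = (fun z => z - a) * _root_.dslope f a from funext hfac]
      rw [analyticOrderAt_mul (by fun_prop) (hg.1.analyticAt a), analyticOrderAt_id_sub_const_self]
    have hn' : (n : ℕ∞) = analyticOrderAt (_root_.dslope f a) a := by
      rw [← hn, Nat.cast_add, Nat.cast_one, add_comm] at hord
      exact ENat.add_right_injective_of_ne_top (by simp) hord
    obtain ⟨m, g, h1, h2, h3⟩ := ih hg (fun h => hb (by rw [hfac, h, mul_zero]))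
      (by rw [← hn']; simp) hn'
    exact ⟨m + 1, g, h1, h2, fun z => by rw [hfac, h3]; ring⟩

theorem HasExponentialType.exists_eq_polynomial_mul (s : Finset ℂ) {f : ℂ → ℂ}
    (hf : HasExponentialType f) {b : ℂ} (hb : f b ≠ 0) (hs : ∀ z, f z = 0 → z ∈ s) :
    ∃ (p : Polynomial ℂ) (g : ℂ → ℂ), HasExponentialType g ∧ (∀ z, g z ≠ 0) ∧
      ∀ z, f z = p.eval z * g z := by
  induction s using Finset.induction_on generalizing f with
  | empty => exact ⟨1, f, hf, fun z h => by simpa using hs z h, by simp⟩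
  | insert a s _ ih =>
    obtain ⟨n, g, h1, h2, h3⟩ := hf.exists_eq_pow_mul hb a
    obtain ⟨p, h, h4, h5, h6⟩ := ih h1 (fun h => hb (by rw [h3, h, mul_zero])) fun z hz => by
      have := hs z (by rw [h3, hz, mul_zero])
      rcases Finset.mem_insert.mp this with rfl | h
      · exact absurd hz h2
      · exact h
    exact ⟨(.X - .C a) ^ n * p, h, h4, h5, fun z => by simp [h3, h6]; ring⟩

/-- By the Borel–Carathéodory theorem an entire logarithm of the function grows linearly, so it is
affine by Liouville's theorem. -/
theorem HasExponentialType.exists_eq_exp {f : ℂ → ℂ} (hf : HasExponentialType f)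
    (h0 : ∀ z, f z ≠ 0) : ∃ a b : ℂ, ∀ z, f z = exp (a * z + b) := by
  obtain ⟨hd, C, hC⟩ := hf
  obtain ⟨g, hg0, hg⟩ := (Differentiable.isExactOn_univ
    (hd.deriv.div hd h0)).with_val_at 0 (log (f 0))
  have hgd : Differentiable ℂ g := fun z => (hg z trivial).differentiableAt
  have hfg : ∀ z, f z = exp (g z) := by
    have hconst : ∀ z w, f z * exp (-g z) = f w * exp (-g w) := by
      refine is_const_of_deriv_eq_zero (by fun_prop) fun z => ?_
      have h1 := (hd z).hasDerivAt.mul (hg z trivial).neg.cexp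
      refine h1.deriv.trans ?_
      simp only [Pi.div_apply]
      field_simp [h0 z]
      ring
    intro z
    have h1 := hconst z 0
    rw [hg0, exp_neg, exp_neg, exp_log (h0 0), mul_inv_cancel₀ (h0 0)] at h1
    rwa [mul_inv_eq_one₀ (exp_ne_zero _)] at h1
  have hre : ∀ z, (g z).re ≤ |C| * (1 + ‖z‖) := by
    intro z
    have h1 := hC z
    rw [hfg, norm_exp, Real.exp_le_exp] at h1
    nlinarith [le_abs_self C, norm_nonneg z]
  -- Borel–Carathéodory in the disk of radius `2 * ‖z‖ + 1`
  have hlin : ∀ z, ‖g z‖ ≤ (4 * (|C| + 1) + 3 * ‖g 0‖) * (1 + ‖z‖) := by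
    intro z
    have hz := norm_nonneg z
    have hM : 0 < (|C| + 1) * (2 + 2 * ‖z‖) := by positivity
    have h1 := borelCaratheodory (f := g) (z := z) (R := 2 * ‖z‖ + 1) hM hgd.differentiableOn
      (fun w hw => by
        have h2 : ‖w‖ < 2 * ‖z‖ + 1 := by simpa using hw
        have h3 := hre w
        have h4 : |C| * (1 + ‖w‖) ≤ (|C| + 1) * (2 + 2 * ‖z‖) := by
          have := abs_nonneg C
          have := norm_nonneg w
          exact mul_le_mul (by linarith) (by linarith) (by positivity) (by positivity)
        exact h3.trans h4) (by positivity) (by simp; linarith)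
    refine h1.trans ?_
    have h5 : 2 * ‖z‖ + 1 - ‖z‖ = 1 + ‖z‖ := by ring
    rw [h5, ← add_div, div_le_iff₀ (by positivity)]
    have h6 := norm_nonneg (g 0)
    have h7 := abs_nonneg C
    have h8 : 2 * ((|C| + 1) * (2 + 2 * ‖z‖)) * ‖z‖ ≤ 4 * (|C| + 1) * (1 + ‖z‖) * (1 + ‖z‖) := by
      have : 2 * ((|C| + 1) * (2 + 2 * ‖z‖)) * ‖z‖ = 4 * (|C| + 1) * (1 + ‖z‖) * ‖z‖ := by ring
      rw [this]; gcongr; linarith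
    have h9 : ‖g 0‖ * (2 * ‖z‖ + 1 + ‖z‖) ≤ 3 * ‖g 0‖ * (1 + ‖z‖) * (1 + ‖z‖) := by
      have e : 3 * ‖g 0‖ * (1 + ‖z‖) * (1 + ‖z‖) - ‖g 0‖ * (2 * ‖z‖ + 1 + ‖z‖)
        = ‖g 0‖ * (2 + 3 * ‖z‖ + 3 * ‖z‖ ^ 2) := by ring
      have : 0 ≤ ‖g 0‖ * (2 + 3 * ‖z‖ + 3 * ‖z‖ ^ 2) := by positivity
      linarith
    linarith
  set K := 4 * (|C| + 1) + 3 * ‖g 0‖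
  have hK : 0 ≤ K := by positivity
  have hsd : Differentiable ℂ (_root_.dslope g 0) := by
    rw [← differentiableOn_univ, Complex.differentiableOn_dslope univ_mem, differentiableOn_univ]
    exact hgd
  have hbdd : Bornology.IsBounded (Set.range (_root_.dslope g 0)) := by
    obtain ⟨N, hN⟩ := (isCompact_closedBall (0 : ℂ) 1).exists_bound_of_continuousOn
      hsd.continuous.continuousOn
    refine (isBounded_iff_forall_norm_le).mpr ⟨max N (2 * K + ‖g 0‖), ?_⟩
    rintro _ ⟨z, rfl⟩
    by_cases hz : z ∈ Metric.closedBall (0 : ℂ) 1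
    · exact (hN z hz).trans (le_max_left _ _)
    · refine le_trans ?_ (le_max_right _ _)
      have hz1 : 1 < ‖z‖ := by simpa using hz
      have hz0 : z ≠ 0 := by rintro rfl; simp at hz1; linarith
      rw [dslope_of_ne _ hz0, slope_def_field, sub_zero, norm_div, div_le_iff₀ (by linarith)]
      have h1 := norm_sub_le (g z) (g 0)
      have h2 := hlin z
      nlinarith [norm_nonneg (g 0)]
  refine ⟨_root_.dslope g 0 0, g 0, fun z => ?_⟩
  have h1 := sub_smul_dslope g 0 z
  rw [hsd.apply_eq_apply_of_bounded hbdd z 0] at h1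
  rw [hfg, show g z = (_root_.dslope g 0 0) * z + g 0 by
    rw [smul_eq_mul, sub_zero] at h1; linear_combination -h1]

/-- The special case of Hadamard's factorization theorem for finitely many zeros. -/
theorem HasExponentialType.exists_eq_polynomial_mul_exp {f : ℂ → ℂ} (hf : HasExponentialType f)
    (hfin : {z | f z = 0}.Finite) : ∃ (p : Polynomial ℂ) (a : ℂ),
      ∀ z, f z = p.eval z * exp (a * z) := by
  obtain ⟨b, hb⟩ : ∃ b, f b ≠ 0 := by
    by_contra! h
    exact Set.infinite_univ (hfin.subset fun z _ => h z)
  obtain ⟨p, g, h1, h2, h3⟩ := hf.exists_eq_polynomial_mul hfin.toFinset hb fun z hz => by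
    simpa using hz
  obtain ⟨a, d, h4⟩ := h1.exists_eq_exp h2
  exact ⟨.C (exp d) * p, a, fun z => by
    rw [h3, h4, exp_add, Polynomial.eval_mul, Polynomial.eval_C]; ring⟩

theorem HasExponentialType.add {f g : ℂ → ℂ} (hf : HasExponentialType f)
    (hg : HasExponentialType g) : HasExponentialType fun z => f z + g z := by
  obtain ⟨h1, C, h2⟩ := hf
  obtain ⟨h3, D, h4⟩ := hg
  refine ⟨h1.add h3, max C D + 1, fun z => ?_⟩
  have hz := norm_nonneg z
  set E := Real.exp (max C D * (1 + ‖z‖)) with hE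
  have h5 : ‖f z‖ ≤ E := (h2 z).trans (Real.exp_le_exp.mpr (by gcongr; exact le_max_left _ _))
  have h6 : ‖g z‖ ≤ E := (h4 z).trans (Real.exp_le_exp.mpr (by gcongr; exact le_max_right _ _))
  have h7 : 2 ≤ Real.exp (1 + ‖z‖) := by linarith [Real.add_one_le_exp (1 + ‖z‖)]
  rw [add_mul, Real.exp_add, one_mul, ← hE]
  have : 0 < E := Real.exp_pos _
  nlinarith [norm_add_le (f z) (g z)]

theorem HasExponentialType.mul {f g : ℂ → ℂ} (hf : HasExponentialType f)
    (hg : HasExponentialType g) : HasExponentialType fun z => f z * g z := by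
  obtain ⟨h1, C, h2⟩ := hf
  obtain ⟨h3, D, h4⟩ := hg
  refine ⟨h1.mul h3, C + D, fun z => ?_⟩
  rw [norm_mul, add_mul, Real.exp_add]
  exact mul_le_mul (h2 z) (h4 z) (norm_nonneg _) (Real.exp_pos _).le

theorem hasExponentialType_exp (a : ℂ) : HasExponentialType fun z => exp (a * z) := by
  refine ⟨by fun_prop, ‖a‖, fun z => ?_⟩
  rw [norm_exp, Real.exp_le_exp]
  calc (a * z).re ≤ ‖a * z‖ := re_le_norm _
    _ = ‖a‖ * ‖z‖ := norm_mul _ _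
    _ ≤ ‖a‖ * (1 + ‖z‖) := by gcongr; linarith

theorem hasExponentialType_polynomial (p : Polynomial ℂ) : HasExponentialType fun z => p.eval z := by
  have hconst : ∀ c : ℂ, HasExponentialType fun _ => c := by
    refine fun c => ⟨by fun_prop, ‖c‖, fun z => ?_⟩
    nlinarith [Real.add_one_le_exp (‖c‖ * (1 + ‖z‖)), norm_nonneg z, norm_nonneg c,
      mul_nonneg (norm_nonneg c) (norm_nonneg z)]
  induction p using Polynomial.induction_on with
  | C a => simpa using hconst a
  | add p q hp hq => simpa using hp.add hq
  | monomial n a h =>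
    have hX : HasExponentialType fun z => z := by
      refine ⟨differentiable_id, 1, fun z => ?_⟩
      linarith [Real.add_one_le_exp (1 * (1 + ‖z‖)), norm_nonneg z]
    simpa [pow_succ, mul_assoc] using h.mul hX

theorem tendsto_eval_mul_exp_neg (p : Polynomial ℂ) (w : ℂ) {δ : ℝ} (hδ : 0 < δ) :
    Tendsto (fun t : ℝ => p.eval (w * t) * exp (-(δ * t : ℝ))) atTop (nhds 0) := by
  induction p using Polynomial.induction_on' with
  | add p q hp hq => simpa [add_mul] using hp.add hq
  | monomial n a =>
    have h1 : Tendsto (fun t : ℝ => t ^ n / Real.exp (δ * t)) atTop (nhds 0) :=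
      (isLittleO_pow_exp_pos_mul_atTop n hδ).tendsto_div_nhds_zero
    have h2 := h1.ofReal.const_mul (a * w ^ n)
    rw [ofReal_zero, mul_zero] at h2
    refine h2.congr fun t => ?_
    rw [exp_neg]
    simp [mul_pow]
    ring

theorem Polynomial.eq_zero_of_tendsto_eval_zero {p : Polynomial ℂ} {w : ℂ} (hw : w ≠ 0)
    (h : Tendsto (fun t : ℝ => p.eval (w * t)) atTop (nhds 0)) : p = 0 := by
  by_cases hp : 0 < p.degree
  · have h1 : Tendsto (fun t : ℝ => ‖w * t‖) atTop atTop := by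
      simp only [norm_mul, norm_real, Real.norm_eq_abs]
      exact tendsto_abs_atTop_atTop.const_mul_atTop (norm_pos_iff.mpr hw)
    exact absurd (p.tendsto_norm_atTop hp h1) (not_tendsto_atTop_of_tendsto_nhds h.norm)
  · rw [Polynomial.eq_C_of_degree_le_zero (not_lt.mp hp)] at h ⊢
    simp only [Polynomial.eval_C] at h
    rw [tendsto_nhds_unique tendsto_const_nhds h, map_zero]

/-- If `P e^{2icz} + Q e^{icz} + W` has finitely many zeros, it equals `p e^{az}` with a polynomial
`p`; comparing the growth on the two halves of the imaginary axis shows that it is `W`. -/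
theorem eq_zero_of_finite_zeros {P Q W : Polynomial ℂ} (hW : W ≠ 0) {c : ℝ} (hc : 0 < c)
    (hfin : {z : ℂ | P.eval z * exp (2 * (I * c * z)) + Q.eval z * exp (I * c * z)
      + W.eval z = 0}.Finite) : P = 0 ∧ Q = 0 := by
  have hE : HasExponentialType fun z => P.eval z * exp (2 * (I * c * z)) + Q.eval z *
      exp (I * c * z) + W.eval z := by
    simp only [← mul_assoc]
    exact (((hasExponentialType_polynomial P).mul (hasExponentialType_exp _)).add
      ((hasExponentialType_polynomial Q).mul (hasExponentialType_exp _))).add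
      (hasExponentialType_polynomial W)
  obtain ⟨p, a, h⟩ := hE.exists_eq_polynomial_mul_exp hfin
  have hup : ∀ t : ℝ, P.eval (I * t) * exp (-(2 * c * t : ℝ)) + Q.eval (I * t) *
      exp (-(c * t : ℝ)) + W.eval (I * t) = p.eval (I * t) * exp (a * (I * t)) := by
    intro t
    rw [← h]
    congr 4 <;> push_cast <;> ring_nf <;> rw [I_sq] <;> ring
  have hdown : ∀ t : ℝ, P.eval (-I * t) * exp (2 * c * t : ℝ) + Q.eval (-I * t) *
      exp (c * t : ℝ) + W.eval (-I * t) = p.eval (-I * t) * exp (a * (-I * t)) := by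
    intro t
    rw [← h]
    congr 4 <;> push_cast <;> ring_nf <;> rw [I_sq] <;> ring
  set β := (a * I).re with hβ
  have hbound : ∀ (w : ℂ) (δ : ℝ) (f : ℝ → ℂ) , 0 < δ → (∀ t, ‖f t‖ = Real.exp (-(δ * t))) →
      Tendsto (fun t : ℝ => p.eval (w * t) * f t) atTop (nhds 0) := by
    intro w δ f hδ hf
    have h1 := (tendsto_eval_mul_exp_neg p w hδ).norm
    rw [norm_zero] at h1
    refine tendsto_zero_iff_norm_tendsto_zero.mpr (h1.congr fun t => ?_)
    rw [norm_mul, norm_mul, hf, norm_exp]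
    simp
  -- if `β < 0`, the right side of `hup` and hence `W` tends to zero along the upper half-axis
  have hβ0 : 0 ≤ β := by
    by_contra! hneg
    apply hW
    refine Polynomial.eq_zero_of_tendsto_eval_zero I_ne_zero ?_
    have h1 := hbound I (-β) (fun t => exp (a * (I * t))) (by linarith) fun t => by
      rw [norm_exp, ← mul_assoc, re_mul_ofReal, hβ]; ring_nf
    have h2 := (h1.sub (tendsto_eval_mul_exp_neg P I (δ := 2 * c) (by positivity))).sub
      (tendsto_eval_mul_exp_neg Q I hc)
    rw [sub_zero, sub_zero] at h2
    exact h2.congr fun t => by rw [← hup]; ring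
  have hexp : ∀ x : ℝ, exp (x : ℂ) * exp (-(x : ℂ)) = 1 := fun x => by rw [← exp_add]; simp
  -- on the lower half-axis the terms of `P`, and then of `Q`, would dominate all others
  have hP : P = 0 := by
    refine Polynomial.eq_zero_of_tendsto_eval_zero (neg_ne_zero.mpr I_ne_zero) ?_
    have h1 := hbound (-I) (β + 2 * c) (fun t => exp (a * (-I * t)) * exp (-(2 * c * t : ℝ)))
      (by positivity) fun t => by
      rw [norm_mul, norm_exp, norm_exp, ← mul_assoc, re_mul_ofReal, ← Real.exp_add, mul_neg,
        neg_re, ← hβ, ← ofReal_neg, ofReal_re]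
      ring_nf
    have h2 := (h1.sub (tendsto_eval_mul_exp_neg Q (-I) hc)).sub
      (tendsto_eval_mul_exp_neg W (-I) (δ := 2 * c) (by positivity))
    rw [sub_zero, sub_zero] at h2
    refine h2.congr fun t => ?_
    have h3 := hdown t
    have e1 := hexp (2 * c * t)
    have e2 := hexp (c * t)
    have e3 : exp ((2 * c * t : ℝ) : ℂ) = exp ((c * t : ℝ) : ℂ) * exp ((c * t : ℝ) : ℂ) := by
      rw [← exp_add]; push_cast; ring_nf
    have e4 : exp (-((2 * c * t : ℝ) : ℂ)) = exp (-((c * t : ℝ) : ℂ)) * exp (-((c * t : ℝ) : ℂ)) := by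
      rw [← exp_add]; push_cast; ring_nf
    rw [← mul_assoc, ← h3, e4, e3]
    generalize exp ((c * t : ℝ) : ℂ) = x at *
    generalize exp (-((c * t : ℝ) : ℂ)) = y at *
    linear_combination (P.eval (-I * t) * (x * y + 1) + Q.eval (-I * t) * y) * e2
  refine ⟨hP, ?_⟩
  refine Polynomial.eq_zero_of_tendsto_eval_zero (neg_ne_zero.mpr I_ne_zero) ?_
  have h1 := hbound (-I) (β + c) (fun t => exp (a * (-I * t)) * exp (-(c * t : ℝ)))
    (by positivity) fun t => by
    rw [norm_mul, norm_exp, norm_exp, ← mul_assoc, re_mul_ofReal, ← Real.exp_add, mul_neg,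
      neg_re, ← hβ, ← ofReal_neg, ofReal_re]
    ring_nf
  have h2 := h1.sub (tendsto_eval_mul_exp_neg W (-I) hc)
  rw [sub_zero] at h2
  refine h2.congr fun t => ?_
  have h3 := hdown t
  have e2 := hexp (c * t)
  rw [← mul_assoc, ← h3, hP, Polynomial.eval_zero]
  linear_combination Q.eval (-I * t) * e2

/-! ### The resonance determinant as an exponential polynomial -/

theorem Matrix.det_updateCol_updateCol_add_smul {n R : Type*} [Fintype n] [DecidableEq n]
    [CommRing R] (A : Matrix n n R) {a b : n} (hab : a ≠ b) (x y u v : n → R) (s t : R) :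
    ((A.updateCol a (x + s • y)).updateCol b (u + t • v)).det =
      ((A.updateCol a x).updateCol b u).det + t * ((A.updateCol a x).updateCol b v).det +
      s * ((A.updateCol a y).updateCol b u).det +
      s * t * ((A.updateCol a y).updateCol b v).det := by
  have h : ∀ w : n → R, ((A.updateCol a (x + s • y)).updateCol b w).det =
      ((A.updateCol a x).updateCol b w).det + s * ((A.updateCol a y).updateCol b w).det := by
    intro w
    rw [updateCol_comm _ hab, det_updateCol_add, det_updateCol_smul, updateCol_comm _ hab.symm,
      updateCol_comm _ hab.symm]
  rw [det_updateCol_add, det_updateCol_smul, h, h]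
  ring

/-- The determinant of a matrix of polynomial functions is a polynomial function. -/
theorem Matrix.exists_polynomial_det {n : Type*} [Fintype n] [DecidableEq n]
    {A : ℂ → Matrix n n ℂ} (h : ∀ i j, ∃ p : Polynomial ℂ, ∀ k, A k i j = p.eval k) :
    ∃ p : Polynomial ℂ, ∀ k, (A k).det = p.eval k := by
  choose p hp using h
  refine ⟨(Matrix.of p).det, fun k => ?_⟩
  rw [← Polynomial.coe_evalRingHom, RingHom.map_det]
  congr 1
  ext i j
  simp [hp]

theorem Matrix.exists_polynomial_updateCol {n : Type*} [DecidableEq n]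
    {A : ℂ → Matrix n n ℂ} (h : ∀ i j, ∃ p : Polynomial ℂ, ∀ k, A k i j = p.eval k)
    {x : ℂ → n → ℂ} (hx : ∀ i, ∃ p : Polynomial ℂ, ∀ k, x k i = p.eval k) (a : n) :
    ∀ i j, ∃ p : Polynomial ℂ, ∀ k, (A k).updateCol a (x k) i j = p.eval k := by
  intro i j
  by_cases hj : j = a
  · simpa [updateCol_apply, hj] using hx i
  · simpa [updateCol_apply, hj] using h i j

/-- The matrix `(1 - k) U - (1 + k)`, which is the image under the coupling condition of the
boundary data `Ψ = 1`, `Ψ' = ik` of waves `exp (ikx)` leaving the vertex; its value at `-k` belongs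
to the waves arriving there. -/
def waveMatrix {n : Type*} [DecidableEq n] (U : Matrix n n ℂ) (k : ℂ) : Matrix n n ℂ :=
  (1 - k) • U - (1 + k) • (1 : Matrix n n ℂ)

theorem exists_polynomial_waveMatrix {n : Type*} [DecidableEq n] (U : Matrix n n ℂ) (i j : n) :
    ∃ p : Polynomial ℂ, ∀ k, waveMatrix U k i j = p.eval k :=
  ⟨(1 - .X) * .C (U i j) - (1 + .X) * .C ((1 : Matrix n n ℂ) i j), fun k => by simp [waveMatrix]⟩

theorem exists_polynomial_waveMatrix_neg {n : Type*} [DecidableEq n] (U : Matrix n n ℂ) (i j : n) :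
    ∃ p : Polynomial ℂ, ∀ k, waveMatrix U (-k) i j = p.eval k :=
  ⟨(1 + .X) * .C (U i j) - (1 - .X) * .C ((1 : Matrix n n ℂ) i j), fun k => by
    simp [waveMatrix, sub_eq_add_neg]⟩

namespace OneEdgeQuantumGraph

variable {M : ℕ} (Γ : OneEdgeQuantumGraph M)

/-- The determinant of the matrix whose first two columns are `x` and `y` and whose other columns
belong to outgoing waves on the leads. -/
def waveDet (k : ℂ) (x y : Fin 2 ⊕ Fin M → ℂ) : ℂ :=
  (((waveMatrix Γ.gaugedCoupling k).updateCol (.inl 0) x).updateCol (.inl 1) y).det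

/-- The expansion of the resonance determinant after the change from `sin kx`, `cos kx` to
`exp (ikx)`, `exp (-ikx)`. -/
theorem resonanceDet_eq (k : ℂ) :
    2 * I * exp (I * Γ.length * k) * Γ.resonanceDet k =
      Γ.waveDet k ((waveMatrix Γ.gaugedCoupling (-k)).col (.inl 1))
        ((waveMatrix Γ.gaugedCoupling (-k)).col (.inl 0)) * exp (2 * (I * Γ.length * k)) +
      (Γ.waveDet k ((waveMatrix Γ.gaugedCoupling k).col (.inl 0))
          ((waveMatrix Γ.gaugedCoupling (-k)).col (.inl 0)) +
        Γ.waveDet k ((waveMatrix Γ.gaugedCoupling (-k)).col (.inl 1))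
          ((waveMatrix Γ.gaugedCoupling k).col (.inl 1))) * exp (I * Γ.length * k) +
      (waveMatrix Γ.gaugedCoupling k).det := by
  set E := exp (I * Γ.length * k) with hE
  set E' := exp (-(I * Γ.length * k)) with hE'
  have hEE : E * E' = 1 := by rw [hE, hE', ← exp_add]; simp
  set U := Γ.gaugedCoupling
  set T : Matrix (Fin 2 ⊕ Fin M) (Fin 2 ⊕ Fin M) ℂ := fromBlocks !![I, -I; 1, 1] 0 0 1
  set S₁ : Matrix (Fin 2 ⊕ Fin M) (Fin 2 ⊕ Fin M) ℂ := fromBlocks !![1, 0; 0, E'] 0 0 1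
  set S₂ : Matrix (Fin 2 ⊕ Fin M) (Fin 2 ⊕ Fin M) ℂ := fromBlocks !![0, 1; E, 0] 0 0 0
  have hEcs : E = cos (k * Γ.length) + sin (k * Γ.length) * I := by
    rw [hE, ← exp_mul_I]; ring_nf
  have hE'cs : E' = cos (k * Γ.length) - sin (k * Γ.length) * I := by
    rw [hE', show -(I * Γ.length * k) = -(k * Γ.length) * I by ring, exp_mul_I, Complex.cos_neg,
      Complex.sin_neg]
    ring
  have hV : Γ.boundaryValues k * T = S₁ + S₂ := by
    simp only [boundaryValues, T, S₁, S₂, fromBlocks_multiply, fromBlocks_add]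
    congr 1
    · ext i j
      fin_cases i <;> fin_cases j <;> simp [hEcs, hE'cs] <;> ring
    all_goals simp
  have hV' : Γ.boundaryDerivs k * T = (I * k) • (S₁ - S₂) := by
    simp only [boundaryDerivs, T, S₁, S₂, fromBlocks_multiply, sub_eq_add_neg, fromBlocks_neg,
      fromBlocks_add, fromBlocks_smul]
    congr 1
    · ext i j
      fin_cases i <;> fin_cases j <;> simp [hEcs, hE'cs] <;> ring_nf <;> simp [I_sq]
    all_goals simp
  have hdetT : T.det = 2 * I := by
    simp only [T, det_fromBlocks_zero₂₁, det_one, mul_one, det_fin_two]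
    simp; ring
  have hmul : ((U - 1) * Γ.boundaryValues k + I • ((U + 1) * Γ.boundaryDerivs k)) * T =
      waveMatrix U k * S₁ + waveMatrix U (-k) * S₂ := by
    rw [add_mul, smul_mul_assoc, mul_assoc, mul_assoc, hV, hV', mul_smul_comm, smul_smul,
      show I * (I * k) = -k by rw [← mul_assoc, I_mul_I]; ring]
    simp only [waveMatrix, sub_mul, mul_add, add_mul, mul_sub, smul_mul_assoc, one_mul, smul_sub,
      smul_add]
    module
  have hcols : waveMatrix U k * S₁ + waveMatrix U (-k) * S₂ =
      ((waveMatrix U k).updateCol (.inl 0)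
        ((waveMatrix U k).col (.inl 0) + E • (waveMatrix U (-k)).col (.inl 1))).updateCol (.inl 1)
        ((waveMatrix U (-k)).col (.inl 0) + E' • (waveMatrix U k).col (.inl 1)) := by
    ext i j
    rcases j with j | j
    · fin_cases j
      · simp [Matrix.mul_apply, Fintype.sum_sum_type, Fin.sum_univ_two, S₁, S₂]
        ring
      · simp [Matrix.mul_apply, Fintype.sum_sum_type, Fin.sum_univ_two, S₁, S₂]
        ring
    · simp [Matrix.mul_apply, Fintype.sum_sum_type, S₁, S₂, Matrix.one_apply]
  have hself : Γ.waveDet k ((waveMatrix U k).col (.inl 0)) ((waveMatrix U k).col (.inl 1)) =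
      (waveMatrix U k).det := by
    rw [waveDet]
    congr 1
    ext i j
    rcases j with j | j
    · fin_cases j <;> simp [U]
    · simp [U]
  have hdet := congrArg Matrix.det hmul
  rw [det_mul, hdetT, hcols, Matrix.det_updateCol_updateCol_add_smul _ (by simp)] at hdet
  change Γ.resonanceDet k * (2 * I) = Γ.waveDet k _ _ + E' * Γ.waveDet k _ _ +
    E * Γ.waveDet k _ _ + E * E' * Γ.waveDet k _ _ at hdet
  rw [hself, hEE] at hdet
  have hE2 : exp (2 * (I * Γ.length * k)) = E * E := by rw [hE, ← exp_add]; ring_nf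
  rw [hE2]
  linear_combination E * hdet + (waveMatrix U k).det * hEE

/-- A Schur complement eliminates the leads: what remains of the coupling matrix is the effective
coupling matrix. -/
theorem det_fromBlocks_leadMatrix {k : ℂ} (hk : IsUnit (Γ.leadMatrix k))
    (J K : Matrix (Fin 2) (Fin 2) ℂ) :
    (fromBlocks (Γ.gaugedCoupling.toBlocks₁₁ * J - K) ((1 - k) • Γ.gaugedCoupling.toBlocks₁₂)
      (Γ.gaugedCoupling.toBlocks₂₁ * J) (Γ.leadMatrix k)).det =
      (Γ.leadMatrix k).det * (Γ.effectiveCoupling k * J - K).det := by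
  let _ := hk.invertible
  rw [det_fromBlocks₂₂, invOf_eq_nonsing_inv]
  congr 2
  simp only [effectiveCoupling, sub_mul, Matrix.smul_mul, Matrix.mul_assoc]
  abel

/-- The coefficient of the middle term of the expansion in terms of the effective coupling
matrix. -/
theorem waveDet_add_waveDet_eq {k : ℂ} (hk : IsUnit (Γ.leadMatrix k)) :
    Γ.waveDet k ((waveMatrix Γ.gaugedCoupling k).col (.inl 0))
        ((waveMatrix Γ.gaugedCoupling (-k)).col (.inl 0)) +
      Γ.waveDet k ((waveMatrix Γ.gaugedCoupling (-k)).col (.inl 1))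
        ((waveMatrix Γ.gaugedCoupling k).col (.inl 1)) =
      -4 * k * (Γ.leadMatrix k).det *
        (Γ.effectiveCoupling k 0 1 + Γ.effectiveCoupling k 1 0) := by
  have h1 : Γ.waveDet k ((waveMatrix Γ.gaugedCoupling k).col (.inl 0))
      ((waveMatrix Γ.gaugedCoupling (-k)).col (.inl 0)) =
      (Γ.leadMatrix k).det * (Γ.effectiveCoupling k * !![1 - k, 1 + k; 0, 0]
        - !![1 + k, 1 - k; 0, 0]).det := by
    rw [← Γ.det_fromBlocks_leadMatrix hk, waveDet]
    congr 1
    ext i j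
    rcases i with i | i <;> rcases j with j | j
    · fin_cases i <;> fin_cases j <;>
        simp [waveMatrix, Matrix.mul_apply, Fin.sum_univ_two, toBlocks₁₁] <;> ring
    · simp [waveMatrix, toBlocks₁₂]
    · fin_cases j <;>
        simp [waveMatrix, Matrix.mul_apply, Fin.sum_univ_two, toBlocks₂₁] <;> ring
    · simp [waveMatrix, toBlocks₂₂, leadMatrix, Matrix.one_apply, add_comm]
  have h2 : Γ.waveDet k ((waveMatrix Γ.gaugedCoupling (-k)).col (.inl 1))
      ((waveMatrix Γ.gaugedCoupling k).col (.inl 1)) =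
      (Γ.leadMatrix k).det * (Γ.effectiveCoupling k * !![0, 0; 1 + k, 1 - k]
        - !![0, 0; 1 - k, 1 + k]).det := by
    rw [← Γ.det_fromBlocks_leadMatrix hk, waveDet]
    congr 1
    ext i j
    rcases i with i | i <;> rcases j with j | j
    · fin_cases i <;> fin_cases j <;>
        simp [waveMatrix, Matrix.mul_apply, Fin.sum_univ_two, toBlocks₁₁] <;> ring
    · simp [waveMatrix, toBlocks₁₂]
    · fin_cases j <;>
        simp [waveMatrix, Matrix.mul_apply, Fin.sum_univ_two, toBlocks₂₁] <;> ring
    · simp [waveMatrix, toBlocks₂₂, leadMatrix, Matrix.one_apply, add_comm]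
  rw [h1, h2]
  simp [det_fin_two, Matrix.mul_apply, Fin.sum_univ_two]
  ring

/-- The condition on the effective coupling matrix extends to `k = 0` by continuity. -/
theorem effectiveCoupling_zero_of_ne_zero
    (h : ∀ k : ℂ, k ≠ 0 → IsUnit (Γ.leadMatrix k) →
      Γ.effectiveCoupling k 0 1 + Γ.effectiveCoupling k 1 0 = 0)
    (h0 : IsUnit (Γ.leadMatrix 0)) :
    Γ.effectiveCoupling 0 0 1 + Γ.effectiveCoupling 0 1 0 = 0 := by
  have hL : Continuous Γ.leadMatrix := by unfold leadMatrix; fun_prop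
  have hdet : Continuous fun k => (Γ.leadMatrix k).det := hL.matrix_det
  have hne : (Γ.leadMatrix 0).det ≠ 0 := ((isUnit_iff_isUnit_det _).mp h0).ne_zero
  have hinv : ContinuousAt (fun k => (Γ.leadMatrix k)⁻¹) 0 := by
    simp only [Matrix.inv_def, Ring.inverse_eq_inv']
    exact (hdet.continuousAt.inv₀ hne).smul hL.matrix_adjugate.continuousAt
  have hcont : ContinuousAt Γ.effectiveCoupling 0 := by
    unfold effectiveCoupling
    have hmul : ∀ {l m n : Type} [Fintype m] (A : ℂ → Matrix l m ℂ) (B : ℂ → Matrix m n ℂ),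
        ContinuousAt A 0 → ContinuousAt B 0 → ContinuousAt (fun k => A k * B k) 0 := by
      intro l m n _ A B hA hB
      exact (continuous_fst.matrix_mul continuous_snd).continuousAt.comp
        (f := fun k => (A k, B k)) (hA.prodMk hB)
    exact continuousAt_const.sub ((by fun_prop : ContinuousAt (fun k : ℂ => 1 - k) 0).smul
      (hmul _ _ (hmul _ _ continuousAt_const hinv) continuousAt_const))
  have hsum : ContinuousAt
      (fun k => Γ.effectiveCoupling k 0 1 + Γ.effectiveCoupling k 1 0) 0 := by
    have e : ∀ i j, ContinuousAt (fun k => Γ.effectiveCoupling k i j) 0 := fun i j =>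
      (continuousAt_pi.mp ((continuousAt_pi.mp hcont) i)) j
    exact (e 0 1).add (e 1 0)
  have hev : ∀ᶠ k : ℂ in nhdsWithin 0 {0}ᶜ,
      Γ.effectiveCoupling k 0 1 + Γ.effectiveCoupling k 1 0 = 0 := by
    filter_upwards [self_mem_nhdsWithin,
      mem_nhdsWithin_of_mem_nhds (hdet.continuousAt.eventually_ne hne)] with k hk hk'
    exact h k hk ((isUnit_iff_isUnit_det _).mpr (isUnit_iff_ne_zero.mpr hk'))
  exact tendsto_nhds_unique (hsum.tendsto.mono_left nhdsWithin_le_nhds)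
    (tendsto_const_nhds.congr' (hev.mono fun k hk => hk.symm))

/-- The resonance determinant is an exponential polynomial whose coefficient `W` does not vanish,
and whose coefficient `Q` vanishes exactly if the effective coupling matrix satisfies the
condition. -/
theorem exists_exponential_polynomial : ∃ P Q W : Polynomial ℂ, W ≠ 0 ∧
    (∀ k, 2 * I * exp (I * Γ.length * k) * Γ.resonanceDet k =
      P.eval k * exp (2 * (I * Γ.length * k)) + Q.eval k * exp (I * Γ.length * k) + W.eval k) ∧
    (Q = 0 ↔ ∀ k : ℂ, IsUnit (Γ.leadMatrix k) →
      Γ.effectiveCoupling k 0 1 + Γ.effectiveCoupling k 1 0 = 0) := by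
  have hB := exists_polynomial_waveMatrix Γ.gaugedCoupling
  have hB' := exists_polynomial_waveMatrix_neg Γ.gaugedCoupling
  have hdet : ∀ x y : ℂ → Fin 2 ⊕ Fin M → ℂ, (∀ i, ∃ p : Polynomial ℂ, ∀ k, x k i = p.eval k) →
      (∀ i, ∃ p : Polynomial ℂ, ∀ k, y k i = p.eval k) →
      ∃ p : Polynomial ℂ, ∀ k, Γ.waveDet k (x k) (y k) = p.eval k := fun x y hx hy =>
    Matrix.exists_polynomial_det (Matrix.exists_polynomial_updateCol
      (Matrix.exists_polynomial_updateCol hB hx _) hy _)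
  obtain ⟨P, hP⟩ := hdet _ _ (fun i => hB' i (.inl 1)) (fun i => hB' i (.inl 0))
  obtain ⟨Q₁, hQ₁⟩ := hdet _ _ (fun i => hB i (.inl 0)) (fun i => hB' i (.inl 0))
  obtain ⟨Q₂, hQ₂⟩ := hdet _ _ (fun i => hB' i (.inl 1)) (fun i => hB i (.inl 1))
  obtain ⟨W, hW⟩ := Matrix.exists_polynomial_det hB
  obtain ⟨L, hL⟩ := Matrix.exists_polynomial_det (A := Γ.leadMatrix) fun i j =>
    ⟨(1 - .X) * .C (Γ.gaugedCoupling.toBlocks₂₂ i j) - (.X + 1) *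
      .C ((1 : Matrix (Fin M) (Fin M) ℂ) i j), fun k => by simp [leadMatrix]⟩
  have hkey : ∀ k, IsUnit (Γ.leadMatrix k) → (Q₁ + Q₂).eval k = -4 * k * (Γ.leadMatrix k).det *
      (Γ.effectiveCoupling k 0 1 + Γ.effectiveCoupling k 1 0) := by
    intro k hk
    rw [Polynomial.eval_add, ← hQ₁, ← hQ₂]
    exact Γ.waveDet_add_waveDet_eq hk
  refine ⟨P, Q₁ + Q₂, W, ?_, fun k => ?_, fun h => ?_, fun h => ?_⟩
  · rintro rfl
    have h1 := hW 1
    simp [waveMatrix, det_neg] at h1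
  · rw [Γ.resonanceDet_eq, Polynomial.eval_add, ← hQ₁, ← hQ₂, ← hP, ← hW]
    rfl
  · have hne : ∀ k : ℂ, k ≠ 0 → IsUnit (Γ.leadMatrix k) →
        Γ.effectiveCoupling k 0 1 + Γ.effectiveCoupling k 1 0 = 0 := by
      intro k hk0 hk
      have h1 := hkey k hk
      rw [h, Polynomial.eval_zero] at h1
      have h2 := ((isUnit_iff_isUnit_det _).mp hk).ne_zero
      have h3 : -4 * k * (Γ.leadMatrix k).det ≠ 0 := by
        refine mul_ne_zero (mul_ne_zero (by norm_num) hk0) h2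
      exact (mul_eq_zero.mp h1.symm).resolve_left h3
    intro k hk
    by_cases hk0 : k = 0
    · subst hk0
      exact Γ.effectiveCoupling_zero_of_ne_zero hne hk
    · exact hne k hk0 hk
  · have hprod : (Q₁ + Q₂) * L = 0 := by
      refine Polynomial.funext fun k => ?_
      rw [Polynomial.eval_mul, Polynomial.eval_zero, ← hL]
      by_cases hk : IsUnit (Γ.leadMatrix k)
      · rw [hkey k hk, h k hk]; ring
      · rw [isUnit_iff_isUnit_det, isUnit_iff_ne_zero, not_not] at hk
        rw [hk, mul_zero]
    refine (mul_eq_zero.mp hprod).resolve_right ?_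
    rintro rfl
    have h1 := hL 1
    simp [leadMatrix, det_neg] at h1

end OneEdgeQuantumGraph

namespace OneEdgeQuantumGraph

variable {M : ℕ} (Γ : OneEdgeQuantumGraph M)

/-! ### Resonances as zeros of the resonance determinant -/

/-- A primitive of the vector potential, the phase of the gauge transformation. -/
theorem exists_phase : ∃ φ : ℝ → ℝ, φ 0 = 0 ∧ φ Γ.length = Γ.flux ∧
    ∀ x ∈ Set.Icc 0 Γ.length, HasDerivAt φ (Γ.potential x) x := by
  set A : ℝ → ℝ := Set.IccExtend Γ.length_pos.le ((Set.Icc 0 Γ.length).domRestrict Γ.potential) with hA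
  have hcont : Continuous A :=
    (continuousOn_iff_continuous_domRestrict.mp Γ.potential_continuousOn).Icc_extend'
  have heq : ∀ x ∈ Set.Icc 0 Γ.length, A x = Γ.potential x := fun x hx =>
    Set.IccExtend_of_mem _ _ hx
  refine ⟨fun x => ∫ t in (0 : ℝ)..x, A t, by simp, ?_, fun x hx => ?_⟩
  · refine intervalIntegral.integral_congr fun x hx => heq x ?_
    rwa [Set.uIcc_of_le Γ.length_pos.le] at hx
  · rw [← heq x hx]
    exact intervalIntegral.integral_hasDerivAt_right (hcont.intervalIntegrable _ _)
      (hcont.stronglyMeasurableAtFilter _ _) hcont.continuousAt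

theorem eq_of_hasDerivWithinAt_zero {h : ℝ → ℂ} {l : ℝ}
    (hh : ∀ x ∈ Set.Icc 0 l, HasDerivWithinAt h 0 (Set.Icc 0 l) x) {x : ℝ}
    (hx : x ∈ Set.Icc 0 l) : h x = h 0 := by
  have h1 := (convex_Icc (0 : ℝ) l).norm_image_sub_le_of_norm_hasDerivWithin_le (C := 0)
    hh (by simp) (Set.left_mem_Icc.mpr (hx.1.trans hx.2)) hx
  rw [zero_mul] at h1
  exact sub_eq_zero.mp (norm_le_zero_iff.mp h1)

theorem hasDerivAt_sin_mul_ofReal (k : ℂ) (x : ℝ) :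
    HasDerivAt (fun x : ℝ => sin (k * x)) (k * cos (k * x)) x := by
  have h := ((hasDerivAt_id (x : ℂ)).const_mul k).csin.comp_ofReal
  simpa [mul_comm] using h

theorem hasDerivAt_cos_mul_ofReal (k : ℂ) (x : ℝ) :
    HasDerivAt (fun x : ℝ => cos (k * x)) (-(k * sin (k * x))) x := by
  have h := ((hasDerivAt_id (x : ℂ)).const_mul k).ccos.comp_ofReal
  simpa [mul_comm] using h

theorem hasDerivAt_exp_I_mul_ofReal {φ : ℝ → ℝ} {a x : ℝ} (h : HasDerivAt φ a x) (s : ℂ) :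
    HasDerivAt (fun x : ℝ => exp (s * φ x)) (s * a * exp (s * φ x)) x := by
  have h := (h.ofReal_comp.const_mul s).cexp
  simpa [mul_comm] using h

/-- After the gauge transformation the solutions on the edge are combinations of `sin kx` and
`cos kx`. -/
theorem solution_eq {k : ℂ} {f g : ℝ → ℂ} {φ : ℝ → ℝ} (hk : k ≠ 0) (hφ0 : φ 0 = 0)
    (hφ : ∀ x ∈ Set.Icc 0 Γ.length, HasDerivAt φ (Γ.potential x) x)
    (hf : ∀ x ∈ Set.Icc 0 Γ.length,
      HasDerivWithinAt f (g x - I * Γ.potential x * f x) (Set.Icc 0 Γ.length) x)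
    (hg : ∀ x ∈ Set.Icc 0 Γ.length,
      HasDerivWithinAt g (-k ^ 2 * f x - I * Γ.potential x * g x) (Set.Icc 0 Γ.length) x)
    {x : ℝ} (hx : x ∈ Set.Icc 0 Γ.length) :
    exp (I * φ x) * f x = g 0 / k * sin (k * x) + f 0 * cos (k * x) ∧
      exp (I * φ x) * g x = k * (g 0 / k * cos (k * x) - f 0 * sin (k * x)) := by
  have hu : ∀ x ∈ Set.Icc 0 Γ.length, HasDerivWithinAt (fun x => exp (I * φ x) * f x)
      (exp (I * φ x) * g x) (Set.Icc 0 Γ.length) x := fun x hx => by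
    refine ((hasDerivAt_exp_I_mul_ofReal (hφ x hx) I).hasDerivWithinAt.mul (hf x hx)).congr_deriv ?_
    ring
  have hv : ∀ x ∈ Set.Icc 0 Γ.length, HasDerivWithinAt (fun x => exp (I * φ x) * g x)
      (-k ^ 2 * (exp (I * φ x) * f x)) (Set.Icc 0 Γ.length) x := fun x hx => by
    refine ((hasDerivAt_exp_I_mul_ofReal (hφ x hx) I).hasDerivWithinAt.mul (hg x hx)).congr_deriv ?_
    ring
  -- two first integrals of `u' = v`, `v' = -k² u`
  have h1 := eq_of_hasDerivWithinAt_zero (l := Γ.length)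
    (h := fun x => k * (exp (I * φ x) * f x) * cos (k * x) - exp (I * φ x) * g x * sin (k * x))
    (fun x hx => by
      refine ((((hu x hx).const_mul k).mul (hasDerivAt_cos_mul_ofReal k x).hasDerivWithinAt).sub
        ((hv x hx).mul (hasDerivAt_sin_mul_ofReal k x).hasDerivWithinAt)).congr_deriv ?_
      ring) hx
  have h2 := eq_of_hasDerivWithinAt_zero (l := Γ.length)
    (h := fun x => k * (exp (I * φ x) * f x) * sin (k * x) + exp (I * φ x) * g x * cos (k * x))
    (fun x hx => by
      refine ((((hu x hx).const_mul k).mul (hasDerivAt_sin_mul_ofReal k x).hasDerivWithinAt).add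
        ((hv x hx).mul (hasDerivAt_cos_mul_ofReal k x).hasDerivWithinAt)).congr_deriv ?_
      ring) hx
  simp only [hφ0, ofReal_zero, mul_zero, exp_zero, Complex.cos_zero, Complex.sin_zero, one_mul,
    mul_one, sub_zero, zero_add] at h1 h2
  have h3 := Complex.sin_sq_add_cos_sq (k * x)
  generalize sin (k * x) = s at *
  generalize cos (k * x) = c at *
  constructor
  · refine mul_left_cancel₀ hk ?_
    field_simp
    linear_combination c * h1 + s * h2 - k * (exp (I * φ x) * f x) * h3
  · field_simp
    linear_combination -s * h1 + c * h2 - (exp (I * φ x) * g x) * h3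

theorem isUnit_det_gauge : IsUnit Γ.gauge.det := by
  rw [gauge, det_diagonal, isUnit_iff_ne_zero, Finset.prod_ne_zero_iff]
  rintro (i | i) -
  · fin_cases i <;> simp
  · simp

theorem gauge_mul_coupling : Γ.gauge * Γ.coupling = Γ.gaugedCoupling * Γ.gauge := by
  rw [gaugedCoupling, Matrix.mul_assoc, nonsing_inv_mul _ Γ.isUnit_det_gauge, Matrix.mul_one]

/-- The gauge transformation turns the coupling matrix `U` into `U_A`. -/
theorem coupling_condition_iff (Ψ Ψ' : Fin 2 ⊕ Fin M → ℂ) :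
    (Γ.coupling - 1) *ᵥ Ψ + I • ((Γ.coupling + 1) *ᵥ Ψ') = 0 ↔
      (Γ.gaugedCoupling - 1) *ᵥ (Γ.gauge *ᵥ Ψ)
        + I • ((Γ.gaugedCoupling + 1) *ᵥ (Γ.gauge *ᵥ Ψ')) = 0 := by
  have h : (Γ.gaugedCoupling - 1) *ᵥ (Γ.gauge *ᵥ Ψ)
      + I • ((Γ.gaugedCoupling + 1) *ᵥ (Γ.gauge *ᵥ Ψ')) =
      Γ.gauge *ᵥ ((Γ.coupling - 1) *ᵥ Ψ + I • ((Γ.coupling + 1) *ᵥ Ψ')) := by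
    rw [mulVec_add, mulVec_smul, mulVec_mulVec, mulVec_mulVec, mulVec_mulVec, mulVec_mulVec,
      Matrix.sub_mul, Matrix.add_mul, Matrix.mul_sub, Matrix.mul_add, gauge_mul_coupling,
      Matrix.one_mul, Matrix.mul_one]
  rw [h]
  constructor
  · intro h0
    rw [h0, mulVec_zero]
  · exact fun h0 => eq_zero_of_mulVec_eq_zero Γ.isUnit_det_gauge.ne_zero h0

theorem gauge_mulVec (y : Fin 2 → ℂ) (c : Fin M → ℂ) :
    Γ.gauge *ᵥ Sum.elim y c = Sum.elim ![y 0, exp (I * Γ.flux) * y 1] c := by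
  ext i
  rw [gauge, mulVec_diagonal]
  rcases i with i | i
  · fin_cases i <;> simp
  · simp

theorem boundaryValues_mulVec (k a b : ℂ) (c : Fin M → ℂ) :
    Γ.boundaryValues k *ᵥ Sum.elim ![a, b] c =
      Sum.elim ![b, a * sin (k * Γ.length) + b * cos (k * Γ.length)] c := by
  rw [boundaryValues, fromBlocks_mulVec]
  ext i
  rcases i with i | i
  · fin_cases i <;> simp
  · simp

theorem boundaryDerivs_mulVec (k a b : ℂ) (c : Fin M → ℂ) :
    Γ.boundaryDerivs k *ᵥ Sum.elim ![a, b] c =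
      Sum.elim ![k * a, -(k * (a * cos (k * Γ.length) - b * sin (k * Γ.length)))]
        fun j => I * k * c j := by
  rw [boundaryDerivs, fromBlocks_mulVec]
  ext i
  rcases i with i | i
  · fin_cases i <;> simp <;> ring
  · simp [smul_mulVec]

theorem isResonance_iff (k : ℂ) : Γ.IsResonance k ↔ k ≠ 0 ∧ Γ.resonanceDet k = 0 := by
  obtain ⟨φ, hφ0, hφl, hφ⟩ := Γ.exists_phase
  have hl : Γ.length ∈ Set.Icc 0 Γ.length := Set.right_mem_Icc.mpr Γ.length_pos.le
  have h0 : (0 : ℝ) ∈ Set.Icc 0 Γ.length := Set.left_mem_Icc.mpr Γ.length_pos.le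
  have hmat : ∀ w : Fin 2 ⊕ Fin M → ℂ, ((Γ.gaugedCoupling - 1) * Γ.boundaryValues k
      + I • ((Γ.gaugedCoupling + 1) * Γ.boundaryDerivs k)) *ᵥ w =
      (Γ.gaugedCoupling - 1) *ᵥ (Γ.boundaryValues k *ᵥ w)
        + I • ((Γ.gaugedCoupling + 1) *ᵥ (Γ.boundaryDerivs k *ᵥ w)) := fun w => by
    rw [add_mulVec, smul_mulVec, mulVec_mulVec, mulVec_mulVec]
  refine and_congr_right fun hk => ?_
  rw [resonanceDet, ← exists_mulVec_eq_zero_iff]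
  constructor
  · rintro ⟨f, g, c, hf, hg, hcond, hne⟩
    have hsol := fun {x : ℝ} => Γ.solution_eq (x := x) hk hφ0 hφ hf hg
    refine ⟨Sum.elim ![g 0 / k, f 0] c, fun hw => ?_, ?_⟩
    · have hc : c = 0 := funext fun j => congrFun hw (.inr j)
      have hg0 : g 0 / k = 0 := congrFun hw (.inl 0)
      have hf0 : f 0 = 0 := congrFun hw (.inl 1)
      rcases hne with ⟨x, hx, hfx⟩ | ⟨j, hj⟩
      · have h1 := (hsol hx).1
        rw [hg0, hf0, zero_mul, zero_mul, add_zero] at h1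
        exact hfx ((mul_eq_zero.mp h1).resolve_left (exp_ne_zero _))
      · exact hj (by rw [hc]; rfl)
    · rw [hmat, boundaryValues_mulVec, boundaryDerivs_mulVec]
      rw [coupling_condition_iff, gauge_mulVec, gauge_mulVec] at hcond
      have h1 := hsol hl
      rw [hφl] at h1
      rw [← h1.1, ← h1.2, mul_div_cancel₀ _ hk]
      simpa using hcond
  · rintro ⟨w, hw0, hw⟩
    set a := w (.inl 0) with ha
    set b := w (.inl 1) with hb
    set c : Fin M → ℂ := fun j => w (.inr j) with hc
    have hwe : w = Sum.elim ![a, b] c := by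
      ext i
      rcases i with i | i
      · fin_cases i <;> rfl
      · rfl
    have hexp : ∀ x : ℝ, exp (I * φ x) * exp (-I * φ x) = 1 := fun x => by
      rw [← exp_add]; simp
    have hφx := fun (x : ℝ) (hx : x ∈ Set.Icc 0 Γ.length) =>
      hasDerivAt_exp_I_mul_ofReal (hφ x hx) (-I)
    refine ⟨fun x => exp (-I * φ x) * (a * sin (k * x) + b * cos (k * x)),
      fun x => exp (-I * φ x) * (k * (a * cos (k * x) - b * sin (k * x))), c,
      fun x hx => ?_, fun x hx => ?_, ?_, ?_⟩
    · refine ((hφx x hx).mul (((hasDerivAt_sin_mul_ofReal k x).const_mul a).add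
        ((hasDerivAt_cos_mul_ofReal k x).const_mul b))).hasDerivWithinAt.congr_deriv ?_
      simp only [Pi.add_apply]
      ring
    · refine ((hφx x hx).mul ((((hasDerivAt_cos_mul_ofReal k x).const_mul a).sub
        ((hasDerivAt_sin_mul_ofReal k x).const_mul b)).const_mul k)).hasDerivWithinAt.congr_deriv ?_
      simp only [Pi.sub_apply]
      ring
    · rw [coupling_condition_iff, gauge_mulVec, gauge_mulVec]
      rw [hmat, hwe, boundaryValues_mulVec, boundaryDerivs_mulVec] at hw
      have h1 := hexp Γ.length
      rw [hφl] at h1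
      have h2 : ∀ y : ℂ, exp (I * Γ.flux) * (exp (-I * Γ.flux) * y) = y := fun y => by
        rw [← mul_assoc, h1, one_mul]
      simp only [hφl, hφ0, Matrix.cons_val_zero, Matrix.cons_val_one, mul_neg, h2]
      simpa using hw
    · by_contra! hcon
      obtain ⟨hf, hc0⟩ := hcon
      have hzero : ∀ x ∈ Set.Icc 0 Γ.length, a * sin (k * x) + b * cos (k * x) = 0 := fun x hx =>
        (mul_eq_zero.mp (hf x hx)).resolve_left (exp_ne_zero _)
      have hb0 : b = 0 := by simpa using hzero 0 h0
      have ha0 : a = 0 := by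
        -- the derivative of the solution vanishes at the vertex as well
        have h1 : HasDerivWithinAt (fun x : ℝ => a * sin (k * x) + b * cos (k * x)) (a * k)
            (Set.Icc 0 Γ.length) 0 := by
          have := ((hasDerivAt_sin_mul_ofReal k 0).const_mul a).add
            ((hasDerivAt_cos_mul_ofReal k 0).const_mul b)
          refine this.hasDerivWithinAt.congr_deriv ?_
          simp
        have h2 : HasDerivWithinAt (fun x : ℝ => a * sin (k * x) + b * cos (k * x)) 0
            (Set.Icc 0 Γ.length) 0 :=
          (hasDerivWithinAt_const (0 : ℝ) (Set.Icc 0 Γ.length) (0 : ℂ)).congr hzero (hzero 0 h0)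
        have h3 := (uniqueDiffOn_Icc Γ.length_pos 0 h0).eq_deriv _ h1 h2
        exact (mul_eq_zero.mp h3).resolve_right hk
      apply hw0
      rw [hwe, ha0, hb0]
      ext i
      rcases i with i | i
      · fin_cases i <;> rfl
      · exact hc0 i

end OneEdgeQuantumGraph

/-! ### The size of the graph -/

theorem exists_exponential_polynomial_ne_zero {P Q W : Polynomial ℂ} (hW : W ≠ 0) {c : ℝ}
    (hc : 0 < c) : ∃ z : ℂ, P.eval z * exp (2 * (I * c * z)) + Q.eval z * exp (I * c * z)
      + W.eval z ≠ 0 := by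
  by_contra! h
  apply hW
  refine Polynomial.eq_zero_of_tendsto_eval_zero I_ne_zero ?_
  have h1 := ((tendsto_eval_mul_exp_neg P I (δ := 2 * c) (by positivity)).add
    (tendsto_eval_mul_exp_neg Q I hc)).neg
  rw [add_zero, neg_zero] at h1
  refine h1.congr fun t => ?_
  have h2 := h (I * t)
  rw [show 2 * (I * c * (I * t)) = -((2 * c * t : ℝ) : ℂ) by
      push_cast; ring_nf; rw [I_sq]; ring,
    show I * c * (I * t) = -((c * t : ℝ) : ℂ) by push_cast; ring_nf; rw [I_sq]; ring] at h2
  linear_combination -h2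

namespace OneEdgeQuantumGraph

variable {M : ℕ} (Γ : OneEdgeQuantumGraph M)

theorem HasEffectiveSize.unique {Γ : OneEdgeQuantumGraph M} {V W : ℝ}
    (hV : Γ.HasEffectiveSize V) (hW : Γ.HasEffectiveSize W) : V = W := by
  have h := hV.sub hW
  by_contra hne
  have hc : 2 / Real.pi * (W - V) ≠ 0 :=
    mul_ne_zero (by positivity) (sub_ne_zero.mpr (Ne.symm hne))
  have h1 : (fun R : ℝ => R) =O[atTop] fun _ => (1 : ℝ) := by
    refine (isBigO_const_mul_left_iff hc).mp (h.congr_left fun R => ?_)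
    ring
  rw [isBigO_one_iff] at h1
  exact not_isBoundedUnder_of_tendsto_atTop
    (tendsto_norm_atTop_atTop) h1

theorem hasEffectiveSize_zero_of_finite (h : {k : ℂ | Γ.IsResonance k}.Finite) :
    Γ.HasEffectiveSize 0 := by
  refine IsBigO.of_bound
    ((∑ᶠ k ∈ {k : ℂ | Γ.IsResonance k}, analyticOrderNatAt Γ.resonanceDet k : ℕ) : ℝ)
    (Eventually.of_forall fun R => ?_)
  rw [mul_zero, zero_mul, sub_zero, norm_one, mul_one, Real.norm_natCast, Nat.cast_le]
  exact finsum_mem_le_finsum_mem_of_subset (fun k hk => hk.1) h _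

theorem differentiable_resonanceDet : Differentiable ℂ Γ.resonanceDet := by
  obtain ⟨P, Q, W, -, hD, -⟩ := Γ.exists_exponential_polynomial
  have h : Γ.resonanceDet = fun k => (P.eval k * exp (2 * (I * Γ.length * k)) +
      Q.eval k * exp (I * Γ.length * k) + W.eval k) / (2 * I * exp (I * Γ.length * k)) := by
    funext k
    rw [← hD, mul_div_cancel_left₀ _ (mul_ne_zero (by simp) (exp_ne_zero _))]
  have := P.differentiable
  have := Q.differentiable
  have := W.differentiable
  rw [h]
  exact Differentiable.div (by fun_prop) (by fun_prop) fun k => mul_ne_zero (by simp) (exp_ne_zero _)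

/-- The resonance determinant is not identically zero; otherwise all its orders of vanishing would
be infinite, and `analyticOrderNatAt` would count them as `0`. -/
theorem exists_resonanceDet_ne_zero : ∃ k, Γ.resonanceDet k ≠ 0 := by
  obtain ⟨P, Q, W, hW, hD, -⟩ := Γ.exists_exponential_polynomial
  obtain ⟨k, hk⟩ := exists_exponential_polynomial_ne_zero (P := P) (Q := Q) hW Γ.length_pos
  exact ⟨k, fun h => hk (by rw [← hD, h, mul_zero])⟩

theorem finite_resonances_of_hasEffectiveSize_zero (h : Γ.HasEffectiveSize 0) :
    {k : ℂ | Γ.IsResonance k}.Finite := by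
  obtain ⟨C, hC⟩ := h.bound
  obtain ⟨R₀, hR₀⟩ := eventually_atTop.mp hC
  obtain ⟨b, hb⟩ := Γ.exists_resonanceDet_ne_zero
  have hd := Γ.differentiable_resonanceDet
  by_contra hinf
  obtain ⟨n, hn⟩ := exists_nat_gt C
  obtain ⟨t, ht, htn⟩ := Set.Infinite.exists_subset_card_eq hinf n
  obtain ⟨R₁, hR₁⟩ := (t.finite_toSet.image norm).bddAbove
  set R := max R₀ R₁
  have hsub : (t : Set ℂ) ⊆ {k : ℂ | Γ.IsResonance k ∧ ‖k‖ ≤ R} := fun k hk =>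
    ⟨ht hk, (hR₁ (Set.mem_image_of_mem _ hk)).trans (le_max_right _ _)⟩
  have hfin : {k : ℂ | Γ.IsResonance k ∧ ‖k‖ ≤ R}.Finite :=
    (finite_zeros_in_closedBall hd hb R).subset fun k hk =>
      ⟨((Γ.isResonance_iff k).mp hk.1).2, hk.2⟩
  have hle : n ≤ Γ.resonanceCount R := by
    refine le_trans ?_ (finsum_mem_le_finsum_mem_of_subset hsub hfin _)
    rw [finsum_mem_coe_finset, ← htn, Finset.card_eq_sum_ones]
    refine Finset.sum_le_sum fun k hk => ?_
    have hzero := ((Γ.isResonance_iff k).mp (ht hk)).2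
    have htop : analyticOrderAt Γ.resonanceDet k ≠ ⊤ := by
      rw [Ne, AnalyticOnNhd.analyticOrderAt_eq_top_iff_eq_zero k fun z => hd.analyticAt z]
      exact fun h0 => hb (congrFun h0 b)
    have hpos : analyticOrderAt Γ.resonanceDet k ≠ 0 :=
      (hd.analyticAt k).analyticOrderAt_ne_zero.mpr hzero
    rw [Nat.one_le_iff_ne_zero, analyticOrderNatAt, Ne, ENat.toNat_eq_zero]
    exact not_or.mpr ⟨hpos, htop⟩
  have h1 := hR₀ R (le_max_left _ _)
  rw [mul_zero, zero_mul, sub_zero, norm_one, mul_one, Real.norm_natCast] at h1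
  have h2 : (n : ℝ) ≤ Γ.resonanceCount R := Nat.cast_le.mpr hle
  linarith

/-- If the middle coefficient vanishes and the other two do not, the graph is Weyl. -/
theorem isWeyl_of_two_terms {P W : Polynomial ℂ} (hP : P ≠ 0) (hW : W ≠ 0)
    (hD : ∀ k, 2 * I * exp (I * Γ.length * k) * Γ.resonanceDet k =
      P.eval k * exp (2 * (I * Γ.length * k)) + W.eval k) : Γ.IsWeyl := by
  have hF : (fun k => P.eval k * exp (I * (2 * Γ.length : ℝ) * k) + W.eval k) =
      (fun k => 2 * I * exp (I * Γ.length * k)) * Γ.resonanceDet := by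
    funext k
    rw [Pi.mul_apply, hD]
    push_cast
    ring_nf
  have hu : Differentiable ℂ fun k : ℂ => 2 * I * exp (I * Γ.length * k) := by fun_prop
  have hu0 : ∀ k : ℂ, 2 * I * exp (I * Γ.length * k) ≠ 0 := fun k =>
    mul_ne_zero (by simp) (exp_ne_zero _)
  have hord : ∀ k, analyticOrderNatAt
      (fun k => P.eval k * exp (I * (2 * Γ.length : ℝ) * k) + W.eval k) k =
      analyticOrderNatAt Γ.resonanceDet k := by
    intro k
    rw [hF, analyticOrderNatAt, analyticOrderNatAt, analyticOrderAt_mul (hu.analyticAt k)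
      (Γ.differentiable_resonanceDet.analyticAt k),
      (hu.analyticAt k).analyticOrderAt_eq_zero.mpr (hu0 k), zero_add]
  have hset : ∀ R : ℝ, {k : ℂ | (k ≠ 0 ∧ P.eval k * exp (I * (2 * Γ.length : ℝ) * k)
      + W.eval k = 0) ∧ ‖k‖ ≤ R} = {k : ℂ | Γ.IsResonance k ∧ ‖k‖ ≤ R} := by
    intro R
    ext k
    have := congrFun hF k
    simp only [Pi.mul_apply] at this
    simp only [Set.mem_ofPred_eq, isResonance_iff, this, mul_eq_zero, hu0 k, false_or]
  refine (isBigO_zero_count hP hW (c := 2 * Γ.length)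
    (mul_pos two_pos Γ.length_pos)).congr_left fun R => ?_
  change ((∑ᶠ k ∈ {k : ℂ | (k ≠ 0 ∧ P.eval k * exp (I * (2 * Γ.length : ℝ) * k)
      + W.eval k = 0) ∧ ‖k‖ ≤ R}, analyticOrderNatAt
        (fun k => P.eval k * exp (I * (2 * Γ.length : ℝ) * k) + W.eval k) k : ℕ) : ℝ) - _ = _
  rw [hset]
  simp only [hord, resonanceCount]
  ring

end OneEdgeQuantumGraph

end

theorem mainTheorem3 {M : ℕ} (Γ : OneEdgeQuantumGraph M) :
    (Γ.HasEffectiveSize 0 ↔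
      Γ.IsNonWeyl ∧ ∀ k : ℂ, IsUnit (Γ.leadMatrix k) →
        Γ.effectiveCoupling k 0 1 + Γ.effectiveCoupling k 1 0 = 0) ∧
    (Γ.HasEffectiveSize 0 ↔ {k : ℂ | Γ.IsResonance k}.Finite) := by
  obtain ⟨P, Q, W, hW, hD, hQ⟩ := Γ.exists_exponential_polynomial
  have hu0 : ∀ k : ℂ, 2 * I * exp (I * Γ.length * k) ≠ 0 := fun k =>
    mul_ne_zero (by simp) (exp_ne_zero _)
  have hzero : ∀ k, P.eval k * exp (2 * (I * Γ.length * k)) + Q.eval k * exp (I * Γ.length * k)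
      + W.eval k = 0 ↔ Γ.resonanceDet k = 0 := fun k => by
    rw [← hD, mul_eq_zero, or_iff_right (hu0 k)]
  refine ⟨⟨fun h => ⟨fun hWeyl => ?_, hQ.mp ?_⟩, fun ⟨hnW, hsum⟩ => ?_⟩,
    Γ.finite_resonances_of_hasEffectiveSize_zero, Γ.hasEffectiveSize_zero_of_finite⟩
  · exact Γ.length_pos.ne (h.unique hWeyl)
  · refine (eq_zero_of_finite_zeros (P := P) hW Γ.length_pos ?_).2
    -- `0` may be a zero of the determinant, but it does not count as a resonance
    refine ((Γ.finite_resonances_of_hasEffectiveSize_zero h).insert 0).subset fun k hk => ?_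
    by_cases hk0 : k = 0
    · exact Or.inl hk0
    · exact Or.inr ((Γ.isResonance_iff k).mpr ⟨hk0, (hzero k).mp hk⟩)
  · rw [← hQ] at hsum
    subst hsum
    have hP : P = 0 := by
      by_contra hP
      exact hnW (Γ.isWeyl_of_two_terms hP hW fun k => by rw [hD]; simp)
    subst hP
    refine Γ.hasEffectiveSize_zero_of_finite ?_
    refine (W.roots.toFinset.finite_toSet).subset fun k hk => ?_
    have h1 := (hzero k).mpr ((Γ.isResonance_iff k).mp hk).2
    simpa [hW] using h1
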